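/- Let $\Bbbk$ be an algebraically closed field, let $H$ be a Hopf algebra over $\Bbbk$ with bijective antipode, and let $R$ be a Hopf algebra in the braided category ${}^H_H\mathcal{YD}$ of left Yetter-Drinfeld modules over $H$. Assume that $R$ is connected, i.e. the coradical of the coalgebra $R$ (the sum of its simple subcoalgebras) is $\Bbbk 1$. Let $L = R\# H$ be the bosonization: the Hopf algebra with underlying space $R\otimes H$, multiplication $(r\# h)(s\# g) = r\,(h_{(1)}\cdot s)\# h_{(2)}g$ and comultiplication $\Delta(r\# h) = r^{(1)}\# (r^{(2)})_{(-1)}h_{(1)} \otimes (r^{(2)})_{(0)}\# h_{(2)}$; let $\mathcal S$ be its antipode. Let $B\subseteq R$ be a left coideal subalgebra, i.e. a subalgebra that is an $H$-subcomodule of $R$ and satisfies $\Delta_R(B)\subseteq R\otimes B$ (it need not be stable under the action of $H$). Then: 1. $B\#1$ is a left coideal subalgebra of $L$, i.e. a subalgebra with $\Delta_L(B\# 1)\subseteq L\otimes (B\# 1)$, and $L$ is a free left $B\#1$-module. 2. The image $Y=\mathcal S(B\#1)$ is a subalgebra of $L$, and $L$ is a free right $Y$-module. In particular, $L$ is a faithfully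 flat right $Y$-module: a sequence $N_1\to N_2\to N_3$ of left $Y$-modules is exact if and only if $L\otimes_Y N_1\to L\otimes_Y N_2\to L\otimes_Y N_3$ is exact. -/

import Mathlib

universe w

open scoped TensorProduct

set_option linter.unusedSectionVars false

noncomputable section

/-! ### Yetter-Drinfeld modules -/

section YetterDrinfeld

open TensorProduct Coalgebra

/-- A (left-left) Yetter-Drinfeld module over a Hopf algebra `H`: a left `H`-module `V` (with
action `act`) which is a left `H`-comodule (with coaction `coact`, `v ↦ v₍₋₁₎ ⊗ v₍₀₎`) such that
`h₍₁₎ v₍₋₁₎ ⊗ h₍₂₎ · v₍₀₎ = (h₍₁₎ · v)₍₋₁₎ h₍₂₎ ⊗ (h₍₁₎ · v)₍₀₎`. -/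
class YetterDrinfeld (k H V : Type*) [Field k] [Ring H] [HopfAlgebra k H]
    [AddCommGroup V] [Module k V] where
  /-- the action of `H` -/
  act : H →ₐ[k] Module.End k V
  /-- the coaction of `H` -/
  coact : V →ₗ[k] H ⊗[k] V
  /-- the coaction is coassociative -/
  coact_coassoc (v : V) :
    TensorProduct.assoc k H H V (comul.rTensor V (coact v)) = coact.lTensor H (coact v)
  /-- the coaction is counital -/
  counit_coact (v : V) : counit.rTensor V (coact v) = 1 ⊗ₜ[k] v
  /-- compatibility of the action and the coaction -/
  compat (h : H) (v : V) :
    ∑ i ∈ (ℛ k h).index,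
        map (LinearMap.mulLeft k ((ℛ k h).left i)) (act ((ℛ k h).right i)) (coact v) =
      ∑ i ∈ (ℛ k h).index,
        (LinearMap.mulRight k ((ℛ k h).right i)).rTensor V (coact (act ((ℛ k h).left i) v))

namespace YetterDrinfeld

variable (k H V W : Type*) [Field k] [Ring H] [HopfAlgebra k H]
  [AddCommGroup V] [Module k V] [YetterDrinfeld k H V]
  [AddCommGroup W] [Module k W] [YetterDrinfeld k H W]

/-- The diagonal action of `H` on `V ⊗ W` through two given actions:
`h · (v ⊗ w) = h₍₁₎ · v ⊗ h₍₂₎ · w`. -/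
def diagAct {k H V W : Type*} [Field k] [Ring H] [HopfAlgebra k H]
    [AddCommGroup V] [Module k V] [AddCommGroup W] [Module k W]
    (a : H →ₐ[k] Module.End k V) (b : H →ₐ[k] Module.End k W) :
    H →ₐ[k] Module.End k (V ⊗[k] W) :=
  Module.endTensorEndAlgHom.comp
    ((Algebra.TensorProduct.map a b).comp (Bialgebra.comulAlgHom k H))

/-- The action of `H` on the tensor product of two Yetter-Drinfeld modules. -/
def tensorAct : H →ₐ[k] Module.End k (V ⊗[k] W) :=
  diagAct (act : H →ₐ[k] Module.End k V) (act : H →ₐ[k] Module.End k W)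

/-- The coaction of `H` on the tensor product of two Yetter-Drinfeld modules:
`v ⊗ w ↦ v₍₋₁₎ w₍₋₁₎ ⊗ (v₍₀₎ ⊗ w₍₀₎)`. -/
def tensorCoact : V ⊗[k] W →ₗ[k] H ⊗[k] (V ⊗[k] W) :=
  (LinearMap.mul' k H).rTensor (V ⊗[k] W) ∘ₗ
    (tensorTensorTensorComm k H V H W).toLinearMap ∘ₗ map coact coact

/-- The braiding `V ⊗ W → W ⊗ V`, `v ⊗ w ↦ v₍₋₁₎ · w ⊗ v₍₀₎`. -/
def braiding : V ⊗[k] W →ₗ[k] W ⊗[k] V :=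
  (TensorProduct.lift (act : H →ₐ[k] Module.End k W).toLinearMap).rTensor V ∘ₗ
    (TensorProduct.assoc k H W V).symm.toLinearMap ∘ₗ
    (TensorProduct.comm k V W).toLinearMap.lTensor H ∘ₗ
    (TensorProduct.assoc k H V W).toLinearMap ∘ₗ
    coact.rTensor W

end YetterDrinfeld
end YetterDrinfeld

/-! ### Hopf algebras in the category of Yetter-Drinfeld modules -/

section Braided

open TensorProduct Coalgebra YetterDrinfeld

/-- The multiplication of the braided tensor product algebra `R ⊗ R`:
`(r ⊗ s)(r' ⊗ s') = r (s₍₋₁₎ · r') ⊗ s₍₀₎ s'`. -/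
def braidedMul (k H R : Type*) [Field k] [Ring H] [HopfAlgebra k H]
    [Ring R] [Algebra k R] [YetterDrinfeld k H R] :
    (R ⊗[k] R) ⊗[k] (R ⊗[k] R) →ₗ[k] R ⊗[k] R :=
  map (LinearMap.mul' k R) (LinearMap.mul' k R) ∘ₗ
    (TensorProduct.assoc k R R (R ⊗[k] R)).symm.toLinearMap ∘ₗ
    ((TensorProduct.assoc k R R R).toLinearMap ∘ₗ
      (braiding k H R R).rTensor R ∘ₗ
      (TensorProduct.assoc k R R R).symm.toLinearMap).lTensor R ∘ₗ
    (TensorProduct.assoc k R R (R ⊗[k] R)).toLinearMap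

/-- A Hopf algebra in the braided category of left Yetter-Drinfeld modules over `H`: an object
`R` of this category with an algebra structure and a coalgebra structure whose structure maps are
morphisms of the category, such that the comultiplication and the counit are algebra maps (for
the braided tensor product algebra `R ⊗ R`), and which has an antipode. -/
class BraidedHopfAlgebra (k H R : Type*) [Field k] [Ring H] [HopfAlgebra k H] [Ring R]
    [Algebra k R] [Coalgebra k R] extends YetterDrinfeld k H R where
  /-- the multiplication is `H`-linear -/
  act_mul (h : H) (x : R ⊗[k] R) :
    act h (LinearMap.mul' k R x) = LinearMap.mul' k R (tensorAct k H R R h x)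
  /-- the multiplication is `H`-colinear -/
  coact_mul (x : R ⊗[k] R) :
    coact (LinearMap.mul' k R x) = (LinearMap.mul' k R).lTensor H (tensorCoact k H R R x)
  /-- the unit is `H`-linear -/
  act_one (h : H) : act h (1 : R) = counit (R := k) h • (1 : R)
  /-- the unit is `H`-colinear -/
  coact_one : coact (1 : R) = 1 ⊗ₜ[k] (1 : R)
  /-- the comultiplication is `H`-linear -/
  comul_act (h : H) (r : R) : comul (R := k) (act h r) = tensorAct k H R R h (comul r)
  /-- the comultiplication is `H`-colinear -/
  coact_comul (r : R) : tensorCoact k H R R (comul r) = comul.lTensor H (coact r)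
  /-- the counit is `H`-linear -/
  counit_act (h : H) (r : R) :
    counit (R := k) (act h r) = counit (R := k) h * counit (R := k) r
  /-- the counit is `H`-colinear -/
  coact_counit (r : R) : counit.lTensor H (coact r) = 1 ⊗ₜ[k] counit (R := k) r
  /-- the counit is unital -/
  counit_one : counit (R := k) (1 : R) = 1
  /-- the counit is multiplicative -/
  counit_mul (r s : R) : counit (R := k) (r * s) = counit (R := k) r * counit (R := k) s
  /-- the comultiplication is unital -/
  comul_one : comul (R := k) (1 : R) = 1 ⊗ₜ[k] 1
  /-- the comultiplication is multiplicative -/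
  comul_mul (r s : R) : comul (R := k) (r * s) = braidedMul k H R (comul r ⊗ₜ[k] comul s)
  /-- the antipode -/
  antipode : R →ₗ[k] R
  /-- the antipode is `H`-linear -/
  antipode_act (h : H) (r : R) : antipode (act h r) = act h (antipode r)
  /-- the antipode is `H`-colinear -/
  coact_antipode (r : R) : coact (antipode r) = antipode.lTensor H (coact r)
  /-- the antipode is a left convolution inverse of the identity -/
  mul_antipode_rTensor_comul (r : R) :
    LinearMap.mul' k R (antipode.rTensor R (comul r)) = algebraMap k R (counit r)
  /-- the antipode is a right convolution inverse of the identity -/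
  mul_antipode_lTensor_comul (r : R) :
    LinearMap.mul' k R (antipode.lTensor R (comul r)) = algebraMap k R (counit r)

end Braided

/-! ### The bosonization -/

section Bosonization

open TensorProduct Coalgebra YetterDrinfeld

/-- The underlying space `R ⊗ H` of the bosonization `R # H`. -/
def Bosonization (k R H : Type*) [Field k] [Ring H] [HopfAlgebra k H] [Ring R]
    [Algebra k R] : Type _ := R ⊗[k] H

namespace Bosonization

instance (k R H : Type*) [Field k] [Ring H] [HopfAlgebra k H] [Ring R]
    [Algebra k R] : AddCommGroup (Bosonization k R H) :=
  inferInstanceAs (AddCommGroup (R ⊗[k] H))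

instance (k R H : Type*) [Field k] [Ring H] [HopfAlgebra k H] [Ring R]
    [Algebra k R] : Module k (Bosonization k R H) :=
  inferInstanceAs (Module k (R ⊗[k] H))

variable (k R H : Type*) [Field k] [Ring H] [HopfAlgebra k H] [Ring R]
  [Algebra k R] [Coalgebra k R] [BraidedHopfAlgebra k H R]

/-- Left multiplication by `r # 1`: `s ⊗ g ↦ r s ⊗ g`. -/
def lam : R →ₐ[k] Module.End k (R ⊗[k] H) :=
  Module.endTensorEndAlgHom.comp
    (Algebra.TensorProduct.includeLeft.comp (Algebra.lmul k R))

/-- Left multiplication by `1 # h`: `s ⊗ g ↦ h₍₁₎ · s ⊗ h₍₂₎ g`. -/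
def alpha : H →ₐ[k] Module.End k (R ⊗[k] H) :=
  diagAct (act : H →ₐ[k] Module.End k R) (Algebra.lmul k H)

/-- Left multiplication in `R # H`: `(r # h)(s # g) = r (h₍₁₎ · s) # h₍₂₎ g`. -/
def mulMap : R ⊗[k] H →ₗ[k] Module.End k (R ⊗[k] H) :=
  LinearMap.mul' k _ ∘ₗ map (lam k R H).toLinearMap (alpha k R H).toLinearMap

variable {k R H}

/-- For linear maps `f : R → A` and `g : H → A`, the map `a ⊗ b ↦ f (a · r) g b`. -/
def twist {A : Type*} [Ring A] [Algebra k A] (f : R →ₗ[k] A) (g : H →ₗ[k] A) (r : R) :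
    H ⊗[k] H →ₗ[k] A :=
  LinearMap.mul' k A ∘ₗ
    map (f ∘ₗ (act : H →ₐ[k] Module.End k R).toLinearMap.flip r) g

lemma twist_tmul {A : Type*} [Ring A] [Algebra k A] (f : R →ₗ[k] A) (g : H →ₗ[k] A) (r : R)
    (a b : H) : twist f g r (a ⊗ₜ b) = f (act (k := k) a r) * g b := by
  simp [twist]

lemma lam_tmul (r s : R) (g : H) : lam k R H r (s ⊗ₜ g) = (r * s) ⊗ₜ g := by
  simp [lam, Module.endTensorEndAlgHom_apply]

lemma alpha_tmul (h : H) (s : R) (g : H) :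
    alpha k R H h (s ⊗ₜ g) = map ((act : H →ₐ[k] Module.End k R).toLinearMap.flip s)
      (LinearMap.mulRight k g) (comul h) := by
  simp only [alpha, diagAct, AlgHom.comp_apply, Bialgebra.comulAlgHom_apply]
  generalize comul (R := k) h = t
  induction t with
  | zero => simp
  | add x y hx hy => simp only [map_add, LinearMap.add_apply, hx, hy]
  | tmul a b => simp [Module.endTensorEndAlgHom_apply]

lemma mulMap_tmul (r : R) (h : H) : mulMap k R H (r ⊗ₜ h) = lam k R H r * alpha k R H h := by
  simp [mulMap]

lemma act_mul' (h : H) (r s : R) : act (k := k) h (r * s) =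
    LinearMap.mul' k R (map ((act : H →ₐ[k] Module.End k R).toLinearMap.flip r)
      ((act : H →ₐ[k] Module.End k R).toLinearMap.flip s) (comul h)) := by
  have := BraidedHopfAlgebra.act_mul (k := k) h (r ⊗ₜ[k] s)
  rw [LinearMap.mul'_apply] at this
  rw [this]
  simp only [tensorAct, diagAct, AlgHom.comp_apply, Bialgebra.comulAlgHom_apply]
  generalize comul (R := k) h = t
  induction t with
  | zero => simp
  | add x y hx hy => simp only [map_add, LinearMap.add_apply, hx, hy]
  | tmul a b => simp [Module.endTensorEndAlgHom_apply]

lemma alpha_mul_lam (h : H) (r : R) : alpha k R H h * lam k R H r =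
    twist (lam k R H).toLinearMap (alpha k R H).toLinearMap r (comul h) := by
  refine TensorProduct.ext' fun s g => ?_
  let G : H ⊗[k] (H ⊗[k] H) →ₗ[k] R ⊗[k] H :=
    map (LinearMap.mul' k R) (LinearMap.mulRight k g) ∘ₗ
    (TensorProduct.assoc k R R H).symm.toLinearMap ∘ₗ
    map ((act : H →ₐ[k] Module.End k R).toLinearMap.flip r)
      (map ((act : H →ₐ[k] Module.End k R).toLinearMap.flip s) LinearMap.id)
  have h1 (t : H ⊗[k] H) : map ((act : H →ₐ[k] Module.End k R).toLinearMap.flip (r * s))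
      (LinearMap.mulRight k g) t = G (TensorProduct.assoc k H H H (comul.rTensor H t)) := by
    induction t with
    | zero => simp
    | add x y hx hy => simp only [map_add, hx, hy]
    | tmul a b =>
      simp only [map_tmul, LinearMap.flip_apply, AlgHom.toLinearMap_apply, act_mul',
        LinearMap.rTensor_tmul]
      generalize comul (R := k) a = u
      induction u with
      | zero => simp
      | add x y hx hy => simp only [map_add, add_tmul, hx, hy]
      | tmul c d => simp [G]
  have h2 (t : H ⊗[k] H) : twist (lam k R H).toLinearMap (alpha k R H).toLinearMap r t (s ⊗ₜ g)
      = G (comul.lTensor H t) := by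
    induction t with
    | zero => simp
    | add x y hx hy => simp only [map_add, LinearMap.add_apply, hx, hy]
    | tmul a b =>
      simp only [twist_tmul, AlgHom.toLinearMap_apply, Module.End.mul_apply, alpha_tmul,
        LinearMap.lTensor_tmul]
      generalize comul (R := k) b = u
      induction u with
      | zero => simp
      | add x y hx hy => simp only [map_add, tmul_add, hx, hy]
      | tmul c d => simp [G, lam_tmul]
  rw [Module.End.mul_apply, lam_tmul, alpha_tmul, h1, h2, coassoc_apply]

lemma mulMap_lam (r : R) (z : R ⊗[k] H) :
    mulMap k R H (lam k R H r z) = lam k R H r * mulMap k R H z := by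
  induction z with
  | zero => simp
  | add x y hx hy => simp only [map_add, mul_add, hx, hy]
  | tmul s g => rw [lam_tmul, mulMap_tmul, mulMap_tmul, map_mul, mul_assoc]

lemma mulMap_alpha (h : H) (z : R ⊗[k] H) :
    mulMap k R H (alpha k R H h z) = alpha k R H h * mulMap k R H z := by
  induction z with
  | zero => simp
  | add x y hx hy => simp only [map_add, mul_add, hx, hy]
  | tmul s g =>
    rw [alpha_tmul, mulMap_tmul, ← mul_assoc, alpha_mul_lam]
    generalize comul (R := k) h = t
    induction t with
    | zero => simp
    | add x y hx hy => simp only [map_add, add_mul, hx, hy]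
    | tmul a b => simp [mulMap_tmul, twist_tmul, mul_assoc]

lemma mulMap_mulMap (x y : R ⊗[k] H) :
    mulMap k R H (mulMap k R H x y) = mulMap k R H x * mulMap k R H y := by
  induction x with
  | zero => simp
  | add x y hx hy => simp only [map_add, add_mul, LinearMap.add_apply, hx, hy]
  | tmul r h =>
    rw [mulMap_tmul, Module.End.mul_apply, mulMap_lam, mulMap_alpha, mul_assoc]

lemma mulMap_one_right (x : R ⊗[k] H) : mulMap k R H x (1 ⊗ₜ 1) = x := by
  induction x with
  | zero => simp
  | add x y hx hy => simp only [map_add, LinearMap.add_apply, hx, hy]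
  | tmul r h =>
    have h1 (t : H ⊗[k] H) : map ((act : H →ₐ[k] Module.End k R).toLinearMap.flip 1)
        (LinearMap.mulRight k 1) t =
        map (Algebra.linearMap k R) LinearMap.id (counit.rTensor H t) := by
      induction t with
      | zero => simp
      | add x y hx hy => simp only [map_add, hx, hy]
      | tmul a b => simp [BraidedHopfAlgebra.act_one, Algebra.algebraMap_eq_smul_one]
    rw [mulMap_tmul, Module.End.mul_apply, alpha_tmul, h1, rTensor_counit_comul, map_tmul,
      lam_tmul]
    simp

instance : Ring (Bosonization k R H) where
  __ := (inferInstance : AddCommGroup (Bosonization k R H))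
  mul x y := mulMap k R H x y
  one := (1 : R) ⊗ₜ[k] (1 : H)
  left_distrib x y z := map_add (mulMap k R H x) y z
  right_distrib x y z := congr($(map_add (mulMap k R H) x y) z)
  zero_mul x := congr($(map_zero (mulMap k R H)) x)
  mul_zero x := map_zero (mulMap k R H x)
  mul_assoc x y z := congr($(mulMap_mulMap (k := k) (R := R) (H := H) x y) z)
  one_mul x := by
    change mulMap k R H ((1 : R) ⊗ₜ[k] (1 : H)) x = x
    simp only [mulMap_tmul, map_one, mul_one]
    rfl
  mul_one x := mulMap_one_right x

instance : Algebra k (Bosonization k R H) :=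
  Algebra.ofModule
    (fun c x y => congr($(map_smul (mulMap k R H) c x) y))
    (fun c x y => map_smul (mulMap k R H x) c y)

variable (k R H) in
/-- The embedding `R → R # H`, `r ↦ r # 1`. -/
def inl : R →ₐ[k] Bosonization k R H :=
  AlgHom.ofLinearMap (B := Bosonization k R H) ((TensorProduct.mk k R H).flip 1) rfl fun r s => by
    change (r * s) ⊗ₜ[k] (1 : H) = mulMap k R H (r ⊗ₜ 1) (s ⊗ₜ 1)
    rw [mulMap_tmul, map_one, mul_one, lam_tmul]

variable (k R H) in
/-- The embedding `H → R # H`, `h ↦ 1 # h`. -/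
def inr : H →ₐ[k] Bosonization k R H :=
  AlgHom.ofLinearMap (B := Bosonization k R H) (TensorProduct.mk k R H 1) rfl fun a b => by
    change (1 : R) ⊗ₜ[k] (a * b) = mulMap k R H (1 ⊗ₜ a) (1 ⊗ₜ b)
    have h1 : alpha k R H b (1 ⊗ₜ 1) = 1 ⊗ₜ b := by
      have := mulMap_one_right (k := k) ((1 : R) ⊗ₜ[k] b)
      rwa [mulMap_tmul, map_one, one_mul] at this
    have h2 := mulMap_one_right (k := k) ((1 : R) ⊗ₜ[k] (a * b))
    rw [mulMap_tmul, map_one, one_mul, map_mul, Module.End.mul_apply, h1] at h2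
    rw [mulMap_tmul, map_one, one_mul, h2]

lemma inl_mul_inr (r : R) (h : H) : inl k R H r * inr k R H h = r ⊗ₜ[k] h := by
  change mulMap k R H (r ⊗ₜ 1) (1 ⊗ₜ h) = r ⊗ₜ[k] h
  rw [mulMap_tmul, map_one, mul_one, lam_tmul, mul_one]

lemma induction {P : Bosonization k R H → Prop} (x : Bosonization k R H)
    (zero : P 0) (add : ∀ x y, P x → P y → P (x + y))
    (mul : ∀ r h, P (inl k R H r * inr k R H h)) : P x := by
  refine TensorProduct.induction_on (motive := P) x zero (fun r h => ?_) add
  rw [← inl_mul_inr]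
  exact mul r h

/-- The commutation relation `g (h) f (r) = f (h₍₁₎ · r) g (h₍₂₎)`. -/
def Compat {A : Type*} [Ring A] [Algebra k A] (f : R →ₗ[k] A) (g : H →ₗ[k] A) : Prop :=
  ∀ (h : H) (r : R), g h * f r = twist f g r (comul h)

lemma compat_inl_inr : Compat (inl k R H).toLinearMap (inr k R H).toLinearMap := by
  intro h r
  change mulMap k R H (1 ⊗ₜ h) (r ⊗ₜ 1) = _
  rw [mulMap_tmul, map_one, one_mul, alpha_tmul]
  generalize comul (R := k) h = t
  induction t with
  | zero => simp; rfl
  | add x y hx hy => simp only [map_add, hx, hy]; rfl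
  | tmul a b =>
    simp only [twist_tmul, AlgHom.toLinearMap_apply, inl_mul_inr]
    simp

/-- The linear map `r # h ↦ f r * g h`. -/
def liftLin {A : Type*} [Ring A] [Algebra k A] (f : R →ₗ[k] A) (g : H →ₗ[k] A) :
    Bosonization k R H →ₗ[k] A :=
  (LinearMap.mul' k A ∘ₗ map f g : R ⊗[k] H →ₗ[k] A)

lemma liftLin_apply {A : Type*} [Ring A] [Algebra k A] (f : R →ₗ[k] A) (g : H →ₗ[k] A)
    (r : R) (h : H) : liftLin f g (inl k R H r * inr k R H h) = f r * g h := by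
  rw [inl_mul_inr]
  change (LinearMap.mul' k A ∘ₗ map f g) (r ⊗ₜ h) = _
  simp

/-- The universal property of `R # H` as an algebra. -/
def lift {A : Type*} [Ring A] [Algebra k A] (f : R →ₐ[k] A) (g : H →ₐ[k] A)
    (hc : Compat f.toLinearMap g.toLinearMap) : Bosonization k R H →ₐ[k] A :=
  have h0 (r : R) (h : H) : liftLin f.toLinearMap g.toLinearMap (inl k R H r * inr k R H h) =
      f r * g h := liftLin_apply _ _ r h
  AlgHom.ofLinearMap (liftLin f.toLinearMap g.toLinearMap)
    (by simpa using h0 1 1)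
    (by
      have hr (r : R) (z : Bosonization k R H) :
          liftLin f.toLinearMap g.toLinearMap (inl k R H r * z) =
            f r * liftLin f.toLinearMap g.toLinearMap z := by
        induction z using induction with
        | zero => simp
        | add x y hx hy => simp only [map_add, mul_add, hx, hy]
        | mul s a => rw [← mul_assoc, ← map_mul, h0, h0, map_mul, mul_assoc]
      have hh (h : H) (z : Bosonization k R H) :
          liftLin f.toLinearMap g.toLinearMap (inr k R H h * z) =
            g h * liftLin f.toLinearMap g.toLinearMap z := by
        induction z using induction with
        | zero => simp
        | add x y hx hy => simp only [map_add, mul_add, hx, hy]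
        | mul s a =>
          have e1 := compat_inl_inr (k := k) (R := R) h s
          have e2 := hc h s
          simp only [AlgHom.toLinearMap_apply] at e1 e2
          rw [← mul_assoc, e1, h0, ← mul_assoc, e2]
          generalize comul (R := k) h = t
          induction t with
          | zero => simp
          | add x y hx hy => simp only [map_add, add_mul, hx, hy]
          | tmul b c =>
            simp only [twist_tmul, AlgHom.toLinearMap_apply]
            rw [mul_assoc, ← map_mul, h0, map_mul, mul_assoc]
      intro x y
      induction x using induction with
      | zero => simp
      | add x y hx hy => simp only [map_add, add_mul, hx, hy]
      | mul r h => rw [mul_assoc, hr, hh, h0, mul_assoc])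

lemma lift_inl {A : Type*} [Ring A] [Algebra k A] (f : R →ₐ[k] A) (g : H →ₐ[k] A)
    (hc : Compat f.toLinearMap g.toLinearMap) (r : R) : lift f g hc (inl k R H r) = f r := by
  have := liftLin_apply f.toLinearMap g.toLinearMap r 1
  simp only [map_one, mul_one, AlgHom.toLinearMap_apply] at this
  exact this

lemma lift_inr {A : Type*} [Ring A] [Algebra k A] (f : R →ₐ[k] A) (g : H →ₐ[k] A)
    (hc : Compat f.toLinearMap g.toLinearMap) (h : H) : lift f g hc (inr k R H h) = g h := by
  have := liftLin_apply f.toLinearMap g.toLinearMap 1 h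
  simp only [map_one, one_mul, AlgHom.toLinearMap_apply] at this
  exact this

lemma algHom_ext {A : Type*} [Ring A] [Algebra k A] {f g : Bosonization k R H →ₐ[k] A}
    (h1 : ∀ r, f (inl k R H r) = g (inl k R H r))
    (h2 : ∀ h, f (inr k R H h) = g (inr k R H h)) : f = g := by
  ext x
  induction x using induction with
  | zero => simp
  | add x y hx hy => simp only [map_add, hx, hy]
  | mul r h => simp only [map_mul, h1, h2]

variable (k R H) in
/-- `r ↦ (r # 1) ⊗ (1 # 1)` -/
def io : R →ₐ[k] Bosonization k R H ⊗[k] Bosonization k R H :=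
  Algebra.TensorProduct.includeLeft.comp (inl k R H)

variable (k R H) in
/-- `h ↦ (1 # h₍₁₎) ⊗ (1 # h₍₂₎)` -/
def gD : H →ₐ[k] Bosonization k R H ⊗[k] Bosonization k R H :=
  (Algebra.TensorProduct.map (inr k R H) (inr k R H)).comp (Bialgebra.comulAlgHom k H)

variable (k R H) in
/-- `a ⊗ r ↦ (1 # a) ⊗ (r # 1)` -/
def psi : H ⊗[k] R →ₐ[k] Bosonization k R H ⊗[k] Bosonization k R H :=
  Algebra.TensorProduct.map (inr k R H) (inl k R H)

variable (k R H) in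
/-- The coaction of a braided Hopf algebra, as an algebra map. -/
def coactAlg : R →ₐ[k] H ⊗[k] R :=
  AlgHom.ofLinearMap coact BraidedHopfAlgebra.coact_one fun r s => by
    have := BraidedHopfAlgebra.coact_mul (k := k) (H := H) (r ⊗ₜ[k] s)
    rw [LinearMap.mul'_apply] at this
    rw [this]
    simp only [tensorCoact, LinearMap.comp_apply, map_tmul]
    generalize coact (k := k) (H := H) r = x
    generalize coact (k := k) (H := H) s = y
    induction x with
    | zero => simp
    | add x x' hx hx' => simp only [add_tmul, map_add, add_mul, hx, hx']
    | tmul a b =>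
      induction y with
      | zero => simp
      | add x x' hx hx' => simp only [tmul_add, map_add, mul_add, hx, hx']
      | tmul c d => simp

variable (k R H) in
/-- `r ↦ (1 # r₍₋₁₎) ⊗ (r₍₀₎ # 1)` -/
def Psi : R →ₐ[k] Bosonization k R H ⊗[k] Bosonization k R H :=
  (psi k R H).comp (coactAlg k R H)

lemma Psi_apply (r : R) : Psi k R H r = psi k R H (coact r) := rfl
lemma gD_apply (h : H) : gD k R H h = map (inr k R H).toLinearMap (inr k R H).toLinearMap
    (comul h) := rfl
lemma io_apply (r : R) : io k R H r = inl k R H r ⊗ₜ[k] 1 := rfl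
lemma psi_tmul (a : H) (r : R) : psi k R H (a ⊗ₜ r) = inr k R H a ⊗ₜ[k] inl k R H r := by
  simp [psi]

variable (k R H) in
/-- `r ⊗ s ↦ (r # s₍₋₁₎) ⊗ (s₍₀₎ # 1)` -/
def FD : R ⊗[k] R →ₗ[k] Bosonization k R H ⊗[k] Bosonization k R H :=
  LinearMap.mul' k _ ∘ₗ map (io k R H).toLinearMap (Psi k R H).toLinearMap

lemma FD_tmul (r s : R) : FD k R H (r ⊗ₜ s) = io k R H r * Psi k R H s := by
  simp [FD]

lemma inr_mul_inl (h : H) (r : R) : inr k R H h * inl k R H r =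
    twist (inl k R H).toLinearMap (inr k R H).toLinearMap r (comul h) := compat_inl_inr h r

lemma Psi_mul_io (r s : R) : Psi k R H r * io k R H s =
    LinearMap.mul' k _ (map ((io k R H).toLinearMap ∘ₗ
      (act : H →ₐ[k] Module.End k R).toLinearMap.flip s) (Psi k R H).toLinearMap (coact r)) := by
  let G : H ⊗[k] (H ⊗[k] R) →ₗ[k] Bosonization k R H ⊗[k] Bosonization k R H :=
    LinearMap.mul' k _ ∘ₗ map ((io k R H).toLinearMap ∘ₗ
      (act : H →ₐ[k] Module.End k R).toLinearMap.flip s) (psi k R H).toLinearMap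
  have h1 (y : H ⊗[k] R) : psi k R H y * io k R H s =
      G (TensorProduct.assoc k H H R (comul.rTensor R y)) := by
    induction y with
    | zero => simp
    | add x y hx hy => simp only [map_add, add_mul, hx, hy]
    | tmul a t =>
      rw [psi_tmul, io_apply, Algebra.TensorProduct.tmul_mul_tmul, inr_mul_inl,
        LinearMap.rTensor_tmul]
      generalize comul (R := k) a = u
      induction u with
      | zero => simp
      | add x y hx hy => simp only [map_add, add_tmul, hx, hy]
      | tmul c d => simp [G, twist_tmul, psi_tmul, io_apply]
  have h2 (y : H ⊗[k] R) : LinearMap.mul' k _ (map ((io k R H).toLinearMap ∘ₗ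
      (act : H →ₐ[k] Module.End k R).toLinearMap.flip s) (Psi k R H).toLinearMap y) =
      G (coact.lTensor H y) := by
    induction y with
    | zero => simp
    | add x y hx hy => simp only [map_add, hx, hy]
    | tmul a t => simp [G, Psi_apply]
  rw [Psi_apply, h1, h2, coact_coassoc]

lemma braidedMul_tmul (a b c d : R) : braidedMul k H R ((a ⊗ₜ b) ⊗ₜ (c ⊗ₜ d)) =
    map (LinearMap.mulLeft k a ∘ₗ (act : H →ₐ[k] Module.End k R).toLinearMap.flip c)
      (LinearMap.mulRight k d) (coact b) := by
  simp only [braidedMul, braiding, LinearMap.comp_apply, LinearEquiv.coe_coe, assoc_tmul,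
    LinearMap.lTensor_tmul, assoc_symm_tmul, LinearMap.rTensor_tmul]
  generalize coact (k := k) (H := H) b = x
  induction x with
  | zero => simp
  | add x y hx hy => simp only [map_add, add_tmul, tmul_add, hx, hy]
  | tmul e f => simp

lemma FD_braidedMul (x y : R ⊗[k] R) :
    FD k R H (braidedMul k H R (x ⊗ₜ y)) = FD k R H x * FD k R H y := by
  induction x with
  | zero => simp
  | add x x' hx hx' => simp only [add_tmul, map_add, add_mul, hx, hx']
  | tmul a b =>
    induction y with
    | zero => simp
    | add x x' hx hx' => simp only [tmul_add, map_add, mul_add, hx, hx']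
    | tmul c d =>
      rw [braidedMul_tmul, FD_tmul, FD_tmul]
      have : io k R H a * Psi k R H b * (io k R H c * Psi k R H d) =
          io k R H a * (Psi k R H b * io k R H c) * Psi k R H d := by simp only [mul_assoc]
      rw [this, Psi_mul_io]
      generalize coact (k := k) (H := H) b = x
      induction x with
      | zero => simp
      | add x y hx hy => simp only [map_add, mul_add, add_mul, hx, hy]
      | tmul e f => simp [FD_tmul, mul_assoc]

variable (k R H) in
/-- `r ↦ (r⁽¹⁾ # (r⁽²⁾)₍₋₁₎) ⊗ ((r⁽²⁾)₍₀₎ # 1)`: the comultiplication of `R # H` on `R`. -/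
def fD : R →ₐ[k] Bosonization k R H ⊗[k] Bosonization k R H :=
  AlgHom.ofLinearMap (FD k R H ∘ₗ comul)
    (by simp [BraidedHopfAlgebra.comul_one (k := k) (H := H), FD_tmul])
    (fun r s => by simp [BraidedHopfAlgebra.comul_mul (k := k) (H := H), FD_braidedMul])

lemma fD_apply (r : R) : fD k R H r = FD k R H (comul r) := rfl

lemma gD_mul_io (h : H) (r : R) : gD k R H h * io k R H r =
    twist (io k R H).toLinearMap (gD k R H).toLinearMap r (comul h) := by
  let G : H ⊗[k] (H ⊗[k] H) →ₗ[k] Bosonization k R H ⊗[k] Bosonization k R H :=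
    LinearMap.mul' k _ ∘ₗ map ((io k R H).toLinearMap ∘ₗ
      (act : H →ₐ[k] Module.End k R).toLinearMap.flip r)
      (map (inr k R H).toLinearMap (inr k R H).toLinearMap)
  have h1 (t : H ⊗[k] H) : map (inr k R H).toLinearMap (inr k R H).toLinearMap t * io k R H r =
      G (TensorProduct.assoc k H H H (comul.rTensor H t)) := by
    induction t with
    | zero => simp
    | add x y hx hy => simp only [map_add, add_mul, hx, hy]
    | tmul a b =>
      rw [map_tmul, io_apply, Algebra.TensorProduct.tmul_mul_tmul, AlgHom.toLinearMap_apply,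
        inr_mul_inl, LinearMap.rTensor_tmul]
      generalize comul (R := k) a = u
      induction u with
      | zero => simp
      | add x y hx hy => simp only [map_add, add_tmul, hx, hy]
      | tmul c d => simp [G, twist_tmul, io_apply]
  have h2 (t : H ⊗[k] H) : twist (io k R H).toLinearMap (gD k R H).toLinearMap r t =
      G (comul.lTensor H t) := by
    induction t with
    | zero => simp
    | add x y hx hy => simp only [map_add, hx, hy]
    | tmul a b => simp [G, twist_tmul, gD_apply]
  rw [gD_apply, h1, h2, coassoc_apply]

lemma sum_eq {M : Type*} [AddCommGroup M] [Module k M] (G : H ⊗[k] H →ₗ[k] M) (h : H) :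
    ∑ i ∈ (ℛ k h).index, G ((ℛ k h).left i ⊗ₜ (ℛ k h).right i) = G (comul h) := by
  rw [← map_sum, (ℛ k h).eq]

lemma gD_mul_Psi (h : H) (r : R) : gD k R H h * Psi k R H r =
    twist (Psi k R H).toLinearMap (gD k R H).toLinearMap r (comul h) := by
  let P : H ⊗[k] H →ₗ[k] H ⊗[k] R :=
    (map₂ (LinearMap.mul k H) (act : H →ₐ[k] Module.End k R).toLinearMap).flip (coact r)
  let Q : H ⊗[k] H →ₗ[k] H ⊗[k] R := LinearMap.mul' k _ ∘ₗ
    map (coact ∘ₗ (act : H →ₐ[k] Module.End k R).toLinearMap.flip r)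
      ((TensorProduct.mk k H R).flip 1)
  have hPQ (a : H) : P (comul a) = Q (comul a) := by
    rw [← sum_eq, ← sum_eq]
    refine Eq.trans ?_ ((YetterDrinfeld.compat a r).trans ?_)
    · refine Finset.sum_congr rfl fun i _ => ?_
      simp only [P, LinearMap.flip_apply, map₂_apply_tmul]
      rfl
    · refine Finset.sum_congr rfl fun i _ => ?_
      simp only [Q, LinearMap.comp_apply, map_tmul, LinearMap.flip_apply,
        AlgHom.toLinearMap_apply, LinearMap.mul'_apply, TensorProduct.mk_apply]
      generalize coact (k := k) (H := H) (V := R) _ = y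
      induction y with
      | zero => simp
      | add x y hx hy => simp only [map_add, add_mul, hx, hy]
      | tmul c d => simp
  let GP (P : H ⊗[k] H →ₗ[k] H ⊗[k] R) :
      (H ⊗[k] H) ⊗[k] H →ₗ[k] Bosonization k R H ⊗[k] Bosonization k R H :=
    LinearMap.mul' k _ ∘ₗ map ((psi k R H).toLinearMap ∘ₗ P)
      (Algebra.TensorProduct.includeRight.comp (inr k R H)).toLinearMap
  have h1 (t : H ⊗[k] H) : map (inr k R H).toLinearMap (inr k R H).toLinearMap t *
      psi k R H (coact r) =
      GP P ((TensorProduct.assoc k H H H).symm (comul.lTensor H t)) := by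
    induction t with
    | zero => simp
    | add x y hx hy => simp only [map_add, add_mul, hx, hy]
    | tmul a b =>
      simp only [P]
      generalize coact (k := k) (H := H) r = y
      induction y with
      | zero => simp [GP]
      | add x y hx hy =>
        simp only [map_add, mul_add, hx, hy]
        rw [← LinearMap.add_apply]
        congr 1
        simp only [GP, LinearMap.comp_add, map_add_left]
      | tmul c d =>
        rw [map_tmul, psi_tmul, Algebra.TensorProduct.tmul_mul_tmul, AlgHom.toLinearMap_apply,
          AlgHom.toLinearMap_apply, inr_mul_inl, LinearMap.lTensor_tmul]
        generalize comul (R := k) b = u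
        induction u with
        | zero => simp
        | add x y hx hy => simp only [map_add, tmul_add, hx, hy]
        | tmul e f => simp [GP, twist_tmul, psi_tmul]
  have h2 (t : H ⊗[k] H) : twist (Psi k R H).toLinearMap (gD k R H).toLinearMap r t =
      GP Q ((TensorProduct.assoc k H H H).symm (comul.lTensor H t)) := by
    induction t with
    | zero => simp
    | add x y hx hy => simp only [map_add, hx, hy]
    | tmul a b =>
      rw [twist_tmul, AlgHom.toLinearMap_apply, AlgHom.toLinearMap_apply, Psi_apply, gD_apply,
        LinearMap.lTensor_tmul]
      generalize comul (R := k) b = u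
      induction u with
      | zero => simp
      | add x y hx hy => simp only [map_add, mul_add, tmul_add, hx, hy]
      | tmul e f => simp [GP, Q, psi_tmul, mul_assoc]
  have h3 (t : H ⊗[k] H) : GP P (comul.rTensor H t) = GP Q (comul.rTensor H t) := by
    induction t with
    | zero => simp
    | add x y hx hy => simp only [map_add, hx, hy]
    | tmul a b => simp [GP, hPQ]
  rw [gD_apply, Psi_apply, h1, h2, coassoc_symm_apply, h3]

lemma gD_mul_FD (h : H) (x : R ⊗[k] R) : gD k R H h * FD k R H x =
    LinearMap.mul' k _ (map (FD k R H ∘ₗ (tensorAct k H R R).toLinearMap.flip x)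
      (gD k R H).toLinearMap (comul h)) := by
  induction x with
  | zero => simp
  | add x y hx hy =>
    rw [map_add, mul_add, hx, hy, map_add, LinearMap.comp_add, map_add_left,
      LinearMap.add_apply, map_add]
  | tmul a b =>
    let G : H ⊗[k] (H ⊗[k] H) →ₗ[k] Bosonization k R H ⊗[k] Bosonization k R H :=
      LinearMap.mul' k _ ∘ₗ map ((io k R H).toLinearMap ∘ₗ
        (act : H →ₐ[k] Module.End k R).toLinearMap.flip a)
        (twist (Psi k R H).toLinearMap (gD k R H).toLinearMap b)
    have h1 (t : H ⊗[k] H) : twist (io k R H).toLinearMap (gD k R H).toLinearMap a t *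
        Psi k R H b = G (comul.lTensor H t) := by
      induction t with
      | zero => simp
      | add x y hx hy => simp only [map_add, add_mul, hx, hy]
      | tmul c d =>
        rw [twist_tmul, AlgHom.toLinearMap_apply, AlgHom.toLinearMap_apply, mul_assoc,
          gD_mul_Psi]
        simp [G]
    have h2 (t : H ⊗[k] H) : LinearMap.mul' k _
        (map (FD k R H ∘ₗ (tensorAct k H R R).toLinearMap.flip (a ⊗ₜ b))
          (gD k R H).toLinearMap t) =
        G (TensorProduct.assoc k H H H (comul.rTensor H t)) := by
      induction t with
      | zero => simp
      | add x y hx hy => simp only [map_add, hx, hy]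
      | tmul c d =>
        simp only [map_tmul, LinearMap.comp_apply, LinearMap.flip_apply,
          AlgHom.toLinearMap_apply, tensorAct, diagAct, AlgHom.comp_apply,
          Bialgebra.comulAlgHom_apply, LinearMap.rTensor_tmul]
        generalize comul (R := k) c = u
        induction u with
        | zero => simp
        | add x y hx hy =>
          simp only [map_add, add_tmul, LinearMap.add_apply, hx, hy]
        | tmul e f =>
          simp [G, Module.endTensorEndAlgHom_apply, FD_tmul, twist_tmul, mul_assoc]
    rw [FD_tmul, ← mul_assoc, gD_mul_io, h1, h2, coassoc_apply]

lemma compat_fD_gD : Compat (fD k R H).toLinearMap (gD k R H).toLinearMap := by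
  intro h r
  simp only [AlgHom.toLinearMap_apply]
  rw [fD_apply, gD_mul_FD]
  have : FD k R H ∘ₗ (tensorAct k H R R).toLinearMap.flip (comul r) =
      (fD k R H).toLinearMap ∘ₗ (act : H →ₐ[k] Module.End k R).toLinearMap.flip r := by
    ext a
    simp [fD_apply, BraidedHopfAlgebra.comul_act]
  rw [this]
  rfl

variable (k R H) in
/-- The comultiplication `r # h ↦ (r⁽¹⁾ # (r⁽²⁾)₍₋₁₎ h₍₁₎) ⊗ ((r⁽²⁾)₍₀₎ # h₍₂₎)`, as the algebra
map with the given values on `R` and `H`. -/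
def comulHom : Bosonization k R H →ₐ[k] Bosonization k R H ⊗[k] Bosonization k R H :=
  lift (fD k R H) (gD k R H) compat_fD_gD

variable (k R H) in
/-- The counit `r # h ↦ ε r * ε h`. -/
def counitHom : Bosonization k R H →ₐ[k] k :=
  lift (AlgHom.ofLinearMap counit (BraidedHopfAlgebra.counit_one (H := H))
      (BraidedHopfAlgebra.counit_mul (H := H))) (Bialgebra.counitAlgHom k H) (by
    intro h r
    have h1 (t : H ⊗[k] H) : twist (counit (R := k) (A := R)) (counit (R := k) (A := H)) r t =
        counit (R := k) r * counit (R := k) (TensorProduct.lid k H (counit.rTensor H t)) := by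
      induction t with
      | zero => simp
      | add x y hx hy => simp only [map_add, mul_add, hx, hy]
      | tmul a b => simp [twist_tmul, BraidedHopfAlgebra.counit_act]; ring
    have := h1 (comul h)
    simp only [rTensor_counit_comul, lid_tmul, one_smul] at this
    exact (mul_comm _ _).trans this.symm)

lemma comulHom_inl (r : R) : comulHom k R H (inl k R H r) = FD k R H (comul r) :=
  lift_inl _ _ _ r
lemma comulHom_inr (h : H) : comulHom k R H (inr k R H h) = gD k R H h :=
  lift_inr _ _ _ h
lemma counitHom_inl (r : R) : counitHom k R H (inl k R H r) = counit r :=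
  lift_inl _ _ _ r
lemma counitHom_inr (h : H) : counitHom k R H (inr k R H h) = counit h :=
  lift_inr _ _ _ h

lemma map_mul_map {A B : Type*} [Ring A] [Algebra k A] [Ring B] [Algebra k B]
    (f : H →ₐ[k] A) (p q : R →ₐ[k] B) (y z : H ⊗[k] R) :
    map f.toLinearMap (LinearMap.mul' k B ∘ₗ map p.toLinearMap q.toLinearMap)
      ((LinearMap.mul' k H).rTensor (R ⊗[k] R)
        (tensorTensorTensorComm k H R H R (y ⊗ₜ z))) =
      map f.toLinearMap p.toLinearMap y * map f.toLinearMap q.toLinearMap z := by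
  induction y with
  | zero => simp
  | add x y hx hy => simp only [map_add, add_tmul, add_mul, hx, hy]
  | tmul a s =>
    induction z with
    | zero => simp
    | add x y hx hy => simp only [map_add, tmul_add, mul_add, hx, hy]
    | tmul b t => simp

lemma Psi_coact (e : R) :
    map (inr k R H).toLinearMap (Psi k R H).toLinearMap (coact e) =
      Algebra.TensorProduct.assoc k k k _ _ _
        (Algebra.TensorProduct.map (comulHom k R H) (.id k _) (Psi k R H e)) := by
  let G : H ⊗[k] (H ⊗[k] R) →ₗ[k]
      Bosonization k R H ⊗[k] (Bosonization k R H ⊗[k] Bosonization k R H) :=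
    map (inr k R H).toLinearMap (psi k R H).toLinearMap
  have h1 (y : H ⊗[k] R) : map (inr k R H).toLinearMap (Psi k R H).toLinearMap y =
      G (coact.lTensor H y) := by
    induction y with
    | zero => simp
    | add x y hx hy => simp only [map_add, hx, hy]
    | tmul a t => simp [G, Psi_apply]
  have h2 (y : H ⊗[k] R) : Algebra.TensorProduct.assoc k k k _ _ _
        (Algebra.TensorProduct.map (comulHom k R H) (.id k _) (psi k R H y)) =
      G (TensorProduct.assoc k H H R (comul.rTensor R y)) := by
    induction y with
    | zero => simp
    | add x y hx hy => simp only [map_add, hx, hy]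
    | tmul a t =>
      simp only [psi_tmul, Algebra.TensorProduct.map_tmul, comulHom_inr, gD_apply,
        LinearMap.rTensor_tmul]
      generalize comul (R := k) a = u
      induction u with
      | zero => simp
      | add x y hx hy => simp only [map_add, add_tmul, hx, hy]
      | tmul c d => simp [G, psi_tmul]
  rw [h1, Psi_apply, h2, coact_coassoc]

lemma comulHom_coassoc : (Algebra.TensorProduct.assoc k k k _ _ _).toAlgHom.comp
      ((Algebra.TensorProduct.map (comulHom k R H) (.id k _)).comp (comulHom k R H))
      = (Algebra.TensorProduct.map (.id k _) (comulHom k R H)).comp (comulHom k R H) := by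
  refine algHom_ext (fun r => ?_) (fun h => ?_)
  · let Θ := (Algebra.TensorProduct.assoc k k k (Bosonization k R H) (Bosonization k R H)
      (Bosonization k R H)).toAlgHom.comp
      (Algebra.TensorProduct.map (comulHom k R H) (.id k _))
    let j2 : R →ₗ[k] Bosonization k R H ⊗[k] (Bosonization k R H ⊗[k] Bosonization k R H) :=
      map (inr k R H).toLinearMap (io k R H).toLinearMap ∘ₗ coact
    let j3 : R →ₗ[k] Bosonization k R H ⊗[k] (Bosonization k R H ⊗[k] Bosonization k R H) :=
      map (inr k R H).toLinearMap (Psi k R H).toLinearMap ∘ₗ coact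
    let M : R ⊗[k] (R ⊗[k] R) →ₗ[k]
        Bosonization k R H ⊗[k] (Bosonization k R H ⊗[k] Bosonization k R H) :=
      LinearMap.mul' k (Bosonization k R H ⊗[k] (Bosonization k R H ⊗[k] Bosonization k R H)) ∘ₗ map
        (Algebra.TensorProduct.includeLeft.comp (inl k R H)).toLinearMap
        (LinearMap.mul' k (Bosonization k R H ⊗[k] (Bosonization k R H ⊗[k] Bosonization k R H)) ∘ₗ map j2 j3)
    have hj2 (d : R) : Algebra.TensorProduct.assoc k k k _ _ _
        (Psi k R H d ⊗ₜ[k] (1 : Bosonization k R H)) = j2 d := by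
      simp only [j2, LinearMap.comp_apply, Psi_apply]
      generalize coact (k := k) (H := H) d = y
      induction y with
      | zero => simp
      | add x y hx hy => simp only [map_add, add_tmul, hx, hy]
      | tmul a t => simp [psi_tmul, io_apply]
    have hΨ (x : R ⊗[k] R) : map (inr k R H).toLinearMap (FD k R H) (tensorCoact k H R R x) =
        LinearMap.mul' k (Bosonization k R H ⊗[k] (Bosonization k R H ⊗[k] Bosonization k R H))
          (map j2 j3 x) := by
      induction x with
      | zero => simp
      | add x y hx hy => simp only [map_add, hx, hy]
      | tmul d e =>
        simp only [tensorCoact, j2, j3, LinearMap.comp_apply, map_tmul, LinearMap.mul'_apply]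
        exact map_mul_map _ _ _ _ _
    have h1 (x : R ⊗[k] R) : Θ (FD k R H x) =
        M (TensorProduct.assoc k R R R (comul.rTensor R x)) := by
      induction x with
      | zero => simp
      | add x y hx hy => simp only [map_add, hx, hy]
      | tmul a b =>
        have e3 : Θ (Psi k R H b) = j3 b := (Psi_coact b).symm
        have e1 : Θ (io k R H a) = Algebra.TensorProduct.assoc k k k _ _ _
            (FD k R H (comul a) ⊗ₜ[k] (1 : Bosonization k R H)) := by
          simp [Θ, io_apply, comulHom_inl]
        rw [FD_tmul, map_mul, e1, e3, LinearMap.rTensor_tmul]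
        generalize comul (R := k) a = u
        induction u with
        | zero => simp
        | add x y hx hy => simp only [map_add, add_tmul, add_mul, hx, hy]
        | tmul c d =>
          have e4 : (FD k R H (c ⊗ₜ[k] d) ⊗ₜ[k] (1 : Bosonization k R H)) =
              (io k R H c ⊗ₜ[k] 1) * (Psi k R H d ⊗ₜ[k] 1) := by simp [FD_tmul]
          rw [e4, map_mul, hj2]
          simp [M, io_apply, mul_assoc, Algebra.TensorProduct.one_def]
    have h2 (x : R ⊗[k] R) :
        Algebra.TensorProduct.map (.id k _) (comulHom k R H) (FD k R H x) =
        M (comul.lTensor R x) := by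
      induction x with
      | zero => simp
      | add x y hx hy => simp only [map_add, hx, hy]
      | tmul a b =>
        have e3 : Algebra.TensorProduct.map (.id k _) (comulHom k R H) (Psi k R H b) =
            map (inr k R H).toLinearMap (FD k R H) (comul.lTensor H (coact b)) := by
          rw [Psi_apply]
          generalize coact (k := k) (H := H) b = y
          induction y with
          | zero => simp
          | add x y hx hy => simp only [map_add, hx, hy]
          | tmul c t => simp [psi_tmul, comulHom_inl]
        rw [FD_tmul, map_mul, e3, ← BraidedHopfAlgebra.coact_comul, hΨ]
        simp [M, io_apply]
    simp only [AlgHom.comp_apply, comulHom_inl, h2]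
    refine (h1 _).trans ?_
    rw [coassoc_apply]
  · have h1 (t : H ⊗[k] H) : (Algebra.TensorProduct.assoc k k k _ _ _).toAlgHom
        (Algebra.TensorProduct.map (comulHom k R H) (.id k _)
          (map (inr k R H).toLinearMap (inr k R H).toLinearMap t)) =
        map (inr k R H).toLinearMap (map (inr k R H).toLinearMap (inr k R H).toLinearMap)
          (TensorProduct.assoc k H H H (comul.rTensor H t)) := by
      induction t with
      | zero => simp
      | add x y hx hy => simp only [map_add, hx, hy]
      | tmul a b =>
        simp only [map_tmul, AlgHom.toLinearMap_apply, Algebra.TensorProduct.map_tmul,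
          comulHom_inr, gD_apply, LinearMap.rTensor_tmul]
        generalize comul (R := k) a = u
        induction u with
        | zero => simp
        | add x y hx hy => simp only [map_add, add_tmul, hx, hy]
        | tmul c d => simp
    have h2 (t : H ⊗[k] H) :
        Algebra.TensorProduct.map (.id k _) (comulHom k R H)
          (map (inr k R H).toLinearMap (inr k R H).toLinearMap t) =
        map (inr k R H).toLinearMap (map (inr k R H).toLinearMap (inr k R H).toLinearMap)
          (comul.lTensor H t) := by
      induction t with
      | zero => simp
      | add x y hx hy => simp only [map_add, hx, hy]
      | tmul a b => simp [comulHom_inr, gD_apply]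
    simp only [AlgHom.comp_apply, comulHom_inr, gD_apply, h1, h2, coassoc_apply]

lemma comulHom_rTensor : (Algebra.TensorProduct.map (counitHom k R H) (.id k _)).comp
    (comulHom k R H) =
      (Algebra.TensorProduct.lid k (Bosonization k R H)).symm.toAlgHom := by
  refine algHom_ext (fun r => ?_) (fun h => ?_)
  · have h1 (x : R ⊗[k] R) : Algebra.TensorProduct.map (counitHom k R H) (.id k _)
        (FD k R H x) = map LinearMap.id (inl k R H).toLinearMap (counit.rTensor R x) := by
      induction x with
      | zero => simp
      | add x y hx hy => simp only [map_add, hx, hy]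
      | tmul a b =>
        have e : Algebra.TensorProduct.map (counitHom k R H) (.id k _) (Psi k R H b) =
            1 ⊗ₜ inl k R H b := by
          have := congr(map LinearMap.id (inl k R H).toLinearMap
            $(counit_coact (k := k) (H := H) b))
          rw [map_tmul] at this
          refine Eq.trans ?_ this
          rw [Psi_apply]
          generalize coact (k := k) (H := H) b = y
          induction y with
          | zero => simp
          | add x y hx hy => simp only [map_add, hx, hy]
          | tmul c t => simp [psi_tmul, counitHom_inr]
        rw [FD_tmul, map_mul, e]
        simp [io_apply, counitHom_inl]
    simp [comulHom_inl, h1]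
  · have h1 (t : H ⊗[k] H) : Algebra.TensorProduct.map (counitHom k R H) (.id k _)
        (map (inr k R H).toLinearMap (inr k R H).toLinearMap t) =
        map LinearMap.id (inr k R H).toLinearMap (counit.rTensor H t) := by
      induction t with
      | zero => simp
      | add x y hx hy => simp only [map_add, hx, hy]
      | tmul a b => simp [counitHom_inr]
    simp [comulHom_inr, gD_apply, h1]

lemma comulHom_lTensor : (Algebra.TensorProduct.map (.id k _) (counitHom k R H)).comp
    (comulHom k R H) =
      (Algebra.TensorProduct.rid k k (Bosonization k R H)).symm.toAlgHom := by
  refine algHom_ext (fun r => ?_) (fun h => ?_)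
  · have h1 (x : R ⊗[k] R) : Algebra.TensorProduct.map (.id k _) (counitHom k R H)
        (FD k R H x) = map (inl k R H).toLinearMap LinearMap.id (counit.lTensor R x) := by
      induction x with
      | zero => simp
      | add x y hx hy => simp only [map_add, hx, hy]
      | tmul a b =>
        have e : Algebra.TensorProduct.map (.id k _) (counitHom k R H) (Psi k R H b) =
            1 ⊗ₜ counit b := by
          have := congr(map (inr k R H).toLinearMap LinearMap.id
            $(BraidedHopfAlgebra.coact_counit (k := k) (H := H) b))
          rw [map_tmul] at this
          refine Eq.trans ?_ (this.trans (by simp))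
          rw [Psi_apply]
          generalize coact (k := k) (H := H) b = y
          induction y with
          | zero => simp
          | add x y hx hy => simp only [map_add, hx, hy]
          | tmul c t => simp [psi_tmul, counitHom_inl]
        rw [FD_tmul, map_mul, e]
        simp [io_apply]
    simp [comulHom_inl, h1]
  · have h1 (t : H ⊗[k] H) : Algebra.TensorProduct.map (.id k _) (counitHom k R H)
        (map (inr k R H).toLinearMap (inr k R H).toLinearMap t) =
        map (inr k R H).toLinearMap LinearMap.id (counit.lTensor H t) := by
      induction t with
      | zero => simp
      | add x y hx hy => simp only [map_add, hx, hy]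
      | tmul a b => simp [counitHom_inr]
    simp [comulHom_inr, gD_apply, h1]

instance : Bialgebra k (Bosonization k R H) :=
  Bialgebra.ofAlgHom (comulHom k R H) (counitHom k R H)
    comulHom_coassoc comulHom_rTensor comulHom_lTensor

variable (k R H) in
/-- `r ↦ (1 # S_H (r₍₋₁₎)) (S_R (r₍₀₎) # 1)`: the antipode of `R # H` on `R`. -/
def sigma : R →ₗ[k] Bosonization k R H :=
  LinearMap.mul' k _ ∘ₗ map ((inr k R H).toLinearMap ∘ₗ HopfAlgebra.antipode k)
    ((inl k R H).toLinearMap ∘ₗ BraidedHopfAlgebra.antipode H) ∘ₗ coact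

variable (k R H) in
/-- The antipode of `R # H`:
`r # h ↦ (1 # S_H (r₍₋₁₎ h)) (S_R (r₍₀₎) # 1) = (1 # S_H h) (1 # S_H (r₍₋₁₎)) (S_R (r₍₀₎) # 1)`. -/
def antipodeMap : Bosonization k R H →ₗ[k] Bosonization k R H :=
  (LinearMap.mul' k _ ∘ₗ
    map ((inr k R H).toLinearMap ∘ₗ HopfAlgebra.antipode k) (sigma k R H) ∘ₗ
    (TensorProduct.comm k R H).toLinearMap : R ⊗[k] H →ₗ[k] Bosonization k R H)

lemma antipodeMap_apply (r : R) (h : H) : antipodeMap k R H (inl k R H r * inr k R H h) =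
    inr k R H (HopfAlgebra.antipode k h) * sigma k R H r := by
  rw [inl_mul_inr]
  change (LinearMap.mul' k _ ∘ₗ
    map ((inr k R H).toLinearMap ∘ₗ HopfAlgebra.antipode k) (sigma k R H) ∘ₗ
    (TensorProduct.comm k R H).toLinearMap) (r ⊗ₜ h) = _
  simp

lemma antipodeMap_mul_inr (x : Bosonization k R H) (h : H) :
    antipodeMap k R H (x * inr k R H h) =
      inr k R H (HopfAlgebra.antipode k h) * antipodeMap k R H x := by
  induction x using induction with
  | zero => simp
  | add x y hx hy => simp only [map_add, add_mul, mul_add, hx, hy]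
  | mul r a =>
    rw [mul_assoc, ← map_mul, antipodeMap_apply, antipodeMap_apply,
      HopfAlgebra.antipode_mul_antidistrib, map_mul, mul_assoc]

lemma antipodeMap_inl (r : R) : antipodeMap k R H (inl k R H r) = sigma k R H r := by
  have := antipodeMap_apply (k := k) (R := R) (H := H) r 1
  simpa using this

lemma antipodeMap_inr (h : H) : antipodeMap k R H (inr k R H h) =
    inr k R H (HopfAlgebra.antipode k h) := by
  have := antipodeMap_mul_inr (k := k) (R := R) (H := H) 1 h
  have h1 : antipodeMap k R H 1 = 1 := by
    have := antipodeMap_inl (k := k) (R := R) (H := H) 1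
    have e : BraidedHopfAlgebra.antipode (k := k) H (1 : R) = 1 := by
      have := BraidedHopfAlgebra.mul_antipode_rTensor_comul (k := k) (H := H) (1 : R)
      simpa [BraidedHopfAlgebra.comul_one (k := k) (H := H),
        BraidedHopfAlgebra.counit_one (k := k) (H := H)] using this
    simpa [sigma, BraidedHopfAlgebra.coact_one, e] using this
  simpa [h1] using this

lemma antipode_left_inl (r : R) : LinearMap.mul' k _
    ((antipodeMap k R H).rTensor _ (FD k R H (comul r))) = algebraMap k _ (counit r) := by
  let N : H ⊗[k] (R ⊗[k] R) →ₗ[k] Bosonization k R H :=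
    LinearMap.mul' k _ ∘ₗ map ((inr k R H).toLinearMap ∘ₗ HopfAlgebra.antipode k)
      ((inl k R H).toLinearMap ∘ₗ LinearMap.mul' k R ∘ₗ
        (BraidedHopfAlgebra.antipode H).rTensor R)
  have h1 (x : R ⊗[k] R) : LinearMap.mul' k _ ((antipodeMap k R H).rTensor _ (FD k R H x)) =
      N (tensorCoact k H R R x) := by
    induction x with
    | zero => simp
    | add x y hx hy => simp only [map_add, hx, hy]
    | tmul a b =>
      simp only [FD_tmul, Psi_apply, tensorCoact, LinearMap.comp_apply, map_tmul]
      generalize coact (k := k) (H := H) b = z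
      induction z with
      | zero => simp
      | add x y hx hy => simp only [map_add, tmul_add, mul_add, hx, hy]
      | tmul c t =>
        simp only [psi_tmul, io_apply, Algebra.TensorProduct.tmul_mul_tmul, one_mul,
          LinearMap.rTensor_tmul, antipodeMap_mul_inr, antipodeMap_inl, LinearMap.mul'_apply,
          sigma, LinearMap.comp_apply]
        generalize coact (k := k) (H := H) a = y
        induction y with
        | zero => simp
        | add x y hx hy => simp only [map_add, add_tmul, mul_add, add_mul, hx, hy]
        | tmul d s => simp [N, HopfAlgebra.antipode_mul_antidistrib, mul_assoc]
  have h2 (y : H ⊗[k] R) : N (comul.lTensor H y) =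
      LinearMap.mul' k _ (map ((inr k R H).toLinearMap ∘ₗ HopfAlgebra.antipode k)
        (Algebra.linearMap k _) (counit.lTensor H y)) := by
    induction y with
    | zero => simp
    | add x y hx hy => simp only [map_add, hx, hy]
    | tmul a t => simp [N, BraidedHopfAlgebra.mul_antipode_rTensor_comul]
  rw [h1, BraidedHopfAlgebra.coact_comul, h2, BraidedHopfAlgebra.coact_counit]
  simp

lemma antipode_right_inl (r : R) : LinearMap.mul' k _
    ((antipodeMap k R H).lTensor _ (FD k R H (comul r))) = algebraMap k _ (counit r) := by
  have h0 (b : R) : LinearMap.mul' k _ (map (inr k R H).toLinearMap (sigma k R H) (coact b)) =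
      inl k R H (BraidedHopfAlgebra.antipode (k := k) H b) := by
    let G : H ⊗[k] (H ⊗[k] R) →ₗ[k] Bosonization k R H :=
      LinearMap.mul' k _ ∘ₗ map (inr k R H).toLinearMap
        (LinearMap.mul' k _ ∘ₗ map ((inr k R H).toLinearMap ∘ₗ HopfAlgebra.antipode k)
          ((inl k R H).toLinearMap ∘ₗ BraidedHopfAlgebra.antipode H))
    have h1 (y : H ⊗[k] R) : LinearMap.mul' k _ (map (inr k R H).toLinearMap (sigma k R H) y) =
        G (coact.lTensor H y) := by
      induction y with
      | zero => simp
      | add x y hx hy => simp only [map_add, hx, hy]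
      | tmul a t => simp [G, sigma]
    have h2 (y : H ⊗[k] R) : G (TensorProduct.assoc k H H R (comul.rTensor R y)) =
        LinearMap.mul' k _ (map (Algebra.linearMap k _)
          ((inl k R H).toLinearMap ∘ₗ BraidedHopfAlgebra.antipode H) (counit.rTensor R y)) := by
      induction y with
      | zero => simp
      | add x y hx hy => simp only [map_add, hx, hy]
      | tmul a t =>
        have e := congr(inr k R H $(HopfAlgebra.mul_antipode_lTensor_comul_apply (R := k) a))
        rw [AlgHom.commutes] at e
        simp only [LinearMap.rTensor_tmul, map_tmul, Algebra.linearMap_apply,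
          LinearMap.mul'_apply]
        rw [← e]
        generalize comul (R := k) a = u
        induction u with
        | zero => simp
        | add x y hx hy => simp only [map_add, add_tmul, add_mul, hx, hy]
        | tmul c d => simp [G, mul_assoc]
    rw [h1, ← coact_coassoc, h2, counit_coact]
    simp
  have h1 (x : R ⊗[k] R) : LinearMap.mul' k _ ((antipodeMap k R H).lTensor _ (FD k R H x)) =
      inl k R H (LinearMap.mul' k R ((BraidedHopfAlgebra.antipode H).lTensor R x)) := by
    induction x with
    | zero => simp
    | add x y hx hy => simp only [map_add, hx, hy]
    | tmul a b =>
      rw [LinearMap.lTensor_tmul, LinearMap.mul'_apply, map_mul, ← h0, FD_tmul, Psi_apply]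
      generalize coact (k := k) (H := H) b = z
      induction z with
      | zero => simp
      | add x y hx hy => simp only [map_add, mul_add, hx, hy]
      | tmul c t => simp [psi_tmul, io_apply, antipodeMap_inl, mul_assoc]
  rw [h1, BraidedHopfAlgebra.mul_antipode_lTensor_comul, AlgHom.commutes]

lemma antipode_left (x : Bosonization k R H) : LinearMap.mul' k _
    ((antipodeMap k R H).rTensor _ (comulHom k R H x)) =
      algebraMap k _ (counitHom k R H x) := by
  induction x using induction with
  | zero => simp
  | add x y hx hy => simp only [map_add, hx, hy]
  | mul r h =>
    have h1 (z : Bosonization k R H ⊗[k] Bosonization k R H) (t : H ⊗[k] H) :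
        LinearMap.mul' k _ ((antipodeMap k R H).rTensor _
          (z * map (inr k R H).toLinearMap (inr k R H).toLinearMap t)) =
        LinearMap.mul' k _ (map LinearMap.id (LinearMap.mulLeft k (LinearMap.mul' k _
          ((antipodeMap k R H).rTensor _ z))) (map
          ((inr k R H).toLinearMap ∘ₗ HopfAlgebra.antipode k) (inr k R H).toLinearMap t)) := by
      induction t with
      | zero => simp
      | add x y hx hy => simp only [map_add, mul_add, hx, hy]
      | tmul a b =>
        induction z with
        | zero => simp
        | add x y hx hy =>
          simp only [add_mul, map_add, hx, hy]
          simp [add_mul, mul_add]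
        | tmul x y => simp [antipodeMap_mul_inr, mul_assoc]
    have h2 (c : k) (t : H ⊗[k] H) :
        LinearMap.mul' k _ (map LinearMap.id
          (LinearMap.mulLeft k (algebraMap k (Bosonization k R H) c)) (map
          ((inr k R H).toLinearMap ∘ₗ HopfAlgebra.antipode k) (inr k R H).toLinearMap t)) =
        c • inr k R H (LinearMap.mul' k H ((HopfAlgebra.antipode k).rTensor H t)) := by
      induction t with
      | zero => simp
      | add x y hx hy => simp only [map_add, smul_add, hx, hy]
      | tmul a b => simp [← Algebra.smul_def]
    rw [map_mul, comulHom_inl, comulHom_inr, gD_apply, h1, antipode_left_inl, h2,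
      HopfAlgebra.mul_antipode_rTensor_comul_apply, AlgHom.commutes, map_mul, counitHom_inl,
      counitHom_inr, map_mul, Algebra.smul_def]

lemma antipode_right (x : Bosonization k R H) : LinearMap.mul' k _
    ((antipodeMap k R H).lTensor _ (comulHom k R H x)) =
      algebraMap k _ (counitHom k R H x) := by
  induction x using induction with
  | zero => simp
  | add x y hx hy => simp only [map_add, hx, hy]
  | mul r h =>
    have h1 (z : Bosonization k R H ⊗[k] Bosonization k R H) (t : H ⊗[k] H) (c : k)
        (ht : LinearMap.mul' k H ((HopfAlgebra.antipode k).lTensor H t) = algebraMap k H c) :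
        LinearMap.mul' k _ ((antipodeMap k R H).lTensor _
          (z * map (inr k R H).toLinearMap (inr k R H).toLinearMap t)) =
        c • LinearMap.mul' k _ ((antipodeMap k R H).lTensor _ z) := by
      induction z with
      | zero => simp
      | add x y hx hy => simp only [add_mul, map_add, hx, hy, smul_add]
      | tmul x y =>
        have h3 (t : H ⊗[k] H) : LinearMap.mul' k _ ((antipodeMap k R H).lTensor _
            (x ⊗ₜ y * map (inr k R H).toLinearMap (inr k R H).toLinearMap t)) =
            x * inr k R H (LinearMap.mul' k H ((HopfAlgebra.antipode k).lTensor H t)) *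
              antipodeMap k R H y := by
          induction t with
          | zero => simp
          | add x y hx hy => simp only [map_add, mul_add, add_mul, hx, hy]
          | tmul a b => simp [antipodeMap_mul_inr, mul_assoc]
        rw [h3, ht, AlgHom.commutes, ← Algebra.commutes, mul_assoc, ← Algebra.smul_def]
        simp
    rw [map_mul, comulHom_inl, comulHom_inr, gD_apply,
      h1 _ _ _ (HopfAlgebra.mul_antipode_lTensor_comul_apply h), antipode_right_inl,
      map_mul, counitHom_inl, counitHom_inr, Algebra.smul_def, ← map_mul, mul_comm]

/-- The Hopf algebra structure of the bosonization `R # H`. -/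
instance : HopfAlgebra k (Bosonization k R H) where
  antipode := antipodeMap k R H
  mul_antipode_rTensor_comul := LinearMap.ext antipode_left
  mul_antipode_lTensor_comul := LinearMap.ext antipode_right

end Bosonization
end Bosonization

/-! ### Coideals, the coradical and connectedness -/

section Coalgebras

open Coalgebra

variable {k C : Type*} [Field k] [AddCommGroup C] [Module k C] [Coalgebra k C]

variable (k) in
/-- A subspace `D` of a coalgebra is a left coideal if `Δ(D) ⊆ C ⊗ D`. -/
def IsLeftCoideal (D : Submodule k C) : Prop :=
  ∀ d ∈ D, comul (R := k) d ∈ LinearMap.range (D.subtype.lTensor C)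

/-- A subspace `D` of a coalgebra is a subcoalgebra if `Δ(D) ⊆ D ⊗ D`. -/
def IsSubcoalgebra (D : Submodule k C) : Prop :=
  ∀ d ∈ D, comul (R := k) d ∈ LinearMap.range (TensorProduct.map D.subtype D.subtype)

/-- A subcoalgebra is simple if it is nonzero and has no proper nonzero subcoalgebra. -/
def IsSimpleSubcoalgebra (D : Submodule k C) : Prop :=
  IsSubcoalgebra D ∧ D ≠ ⊥ ∧ ∀ E ≤ D, IsSubcoalgebra E → E = ⊥ ∨ E = D

variable (k C) in
/-- The coradical of a coalgebra: the sum of its simple subcoalgebras. -/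
def coradical : Submodule k C :=
  sSup {D | IsSimpleSubcoalgebra D}

/-- A braided Hopf algebra `R` is connected if the coradical of its underlying coalgebra is the
line spanned by the unit. -/
def IsConnectedCoalgebra (k R : Type*) [Field k] [Ring R] [Algebra k R] [Coalgebra k R] : Prop :=
  coradical k R = Submodule.span k {1}

end Coalgebras

section Coideals

/-- A subspace `D` of a Yetter-Drinfeld module is an `H`-subcomodule if the coaction maps it into
`H ⊗ D`. -/
def IsSubcomodule {k V : Type*} (H : Type*) [Field k] [Ring H] [HopfAlgebra k H]
    [AddCommGroup V] [Module k V] [YetterDrinfeld k H V] (D : Submodule k V) : Prop :=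
  ∀ d ∈ D, YetterDrinfeld.coact (k := k) (H := H) d ∈ LinearMap.range (D.subtype.lTensor H)

/-- A subalgebra `B` of a braided Hopf algebra `R` is a left coideal subalgebra if it is an
`H`-subcomodule of `R` and `Δ(B) ⊆ R ⊗ B`. Stability under the action of `H` is not required. -/
def IsBraidedLeftCoidealSubalgebra {k R : Type*} (H : Type*) [Field k] [Ring H]
    [HopfAlgebra k H] [Ring R] [Algebra k R] [Coalgebra k R] [BraidedHopfAlgebra k H R]
    (B : Subalgebra k R) : Prop :=
  IsSubcomodule H (Subalgebra.toSubmodule B) ∧ IsLeftCoideal k (Subalgebra.toSubmodule B)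

/-- The subalgebra `B # 1` of `R # H`. -/
def Bosonization.ofSubalgebra {k R : Type*} (H : Type*) [Field k] [Ring H]
    [HopfAlgebra k H] [Ring R] [Algebra k R] [Coalgebra k R] [BraidedHopfAlgebra k H R]
    (B : Subalgebra k R) : Subalgebra k (Bosonization k R H) :=
  B.map (Bosonization.inl k R H)

/-- The image `S(B)` of a subalgebra `B` of a Hopf algebra under the antipode. -/
def antipodeImage {k A : Type*} [Field k] [Ring A] [HopfAlgebra k A] (B : Subalgebra k A) :
    Subalgebra k A where
  carrier := HopfAlgebra.antipode k '' (B : Set A)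
  mul_mem' := by
    rintro _ _ ⟨a, ha, rfl⟩ ⟨b, hb, rfl⟩
    exact ⟨b * a, B.mul_mem hb ha, HopfAlgebra.antipode_mul_antidistrib b a⟩
  add_mem' := by
    rintro _ _ ⟨a, ha, rfl⟩ ⟨b, hb, rfl⟩
    exact ⟨a + b, B.add_mem ha hb, map_add _ a b⟩
  algebraMap_mem' c := ⟨algebraMap k A c, B.algebraMap_mem c, by
    simp [Algebra.algebraMap_eq_smul_one]⟩

end Coideals

/-! ### Modules over noncommutative rings -/

section Modules

open MulOpposite

variable (A : Type*) [Ring A] (M : Type*) [AddCommGroup M] [Module Aᵐᵒᵖ M]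

/-- The relations `m a ⊗ n = m ⊗ a n` for a right module `M` and a left module `N`. -/
def balancedRel (N : Type*) [AddCommGroup N] [Module A N] : AddSubgroup (M ⊗[ℤ] N) :=
  AddSubgroup.closure
    {z | ∃ (m : M) (a : A) (n : N), z = (op a • m) ⊗ₜ[ℤ] n - m ⊗ₜ[ℤ] (a • n)}

/-- The tensor product `M ⊗_A N` of a right module `M` and a left module `N`. -/
abbrev BalancedTensor (N : Type*) [AddCommGroup N] [Module A N] : Type _ :=
  (M ⊗[ℤ] N) ⧸ balancedRel A M N

/-- The map `id ⊗ f : M ⊗_A N → M ⊗_A N'`. -/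
def balancedLTensor {N N' : Type*} [AddCommGroup N] [Module A N] [AddCommGroup N'] [Module A N']
    (f : N →ₗ[A] N') : BalancedTensor A M N →+ BalancedTensor A M N' :=
  QuotientAddGroup.map _ _
    (f.toAddMonoidHom.toIntLinearMap.lTensor M : M ⊗[ℤ] N →ₗ[ℤ] M ⊗[ℤ] N').toAddMonoidHom <| by
    refine (AddSubgroup.closure_le _).2 ?_
    rintro _ ⟨m, a, n, rfl⟩
    refine AddSubgroup.subset_closure ⟨m, a, f n, ?_⟩
    rw [map_sub, ← map_smul]
    rfl

end Modules

/-- A right `A`-module `M` is faithfully flat if a sequence `N₁ → N₂ → N₃` of left `A`-modules is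
exact if and only if `M ⊗_A N₁ → M ⊗_A N₂ → M ⊗_A N₃` is exact. -/
def IsRightFaithfullyFlat.{w', u, v} (A : Type u) [Ring A] (M : Type v) [AddCommGroup M]
    [Module Aᵐᵒᵖ M] : Prop :=
  ∀ (N₁ N₂ N₃ : Type w') [AddCommGroup N₁] [AddCommGroup N₂] [AddCommGroup N₃]
    [Module A N₁] [Module A N₂] [Module A N₃] (f : N₁ →ₗ[A] N₂) (g : N₂ →ₗ[A] N₃),
    Function.Exact f g ↔ Function.Exact (balancedLTensor A M f) (balancedLTensor A M g)

/-- An algebra `A` as a right module over a subalgebra `Y`, by right multiplication. -/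
@[reducible]
def rightModule {k A : Type*} [Field k] [Ring A] [Algebra k A] (Y : Subalgebra k A) :
    Module (↥Y)ᵐᵒᵖ A :=
  Module.compHom A (RingHom.op (Y.val : Y →+* A))

/-- `A` is a free left module over its subalgebra `B`. -/
def IsLeftFreeOver {k A : Type*} [Field k] [Ring A] [Algebra k A] (B : Subalgebra k A) : Prop :=
  Module.Free B A

/-- `A` is a free right module over its subalgebra `Y`. -/
def IsRightFreeOver {k A : Type*} [Field k] [Ring A] [Algebra k A] (Y : Subalgebra k A) : Prop :=
  letI := rightModule Y
  Module.Free (↥Y)ᵐᵒᵖ A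

/-- `A` is a faithfully flat right module over its subalgebra `Y`. -/
def IsRightFaithfullyFlatOver.{w', u, v} {k : Type u} {A : Type v} [Field k] [Ring A]
    [Algebra k A] (Y : Subalgebra k A) : Prop :=
  letI := rightModule Y
  IsRightFaithfullyFlat.{w'} Y A

end

/-!
The bosonization `L = R # H` is, as a left module over `B # 1 ≅ B`, the extension `R ⊗ H` of the
left `B`-module `R`. So the left-hand freeness reduces to that of `R` over `B`; the right-hand
freeness follows because the antipode of `L` is bijective and turns left multiplication by `B # 1`
into right multiplication by its image; and a nonzero free right module is faithfully flat.

Connectedness enters through a filtration of `R`. Let `𝔪` be the ideal of functionals vanishing at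
`1` in the convolution algebra of functionals on `R`. The elements orthogonal to a power of `𝔪`
exhaust `R` (`exists_mem_groupLikeFiltration`): an element lies in a finite-dimensional subcoalgebra
`V`, whose dual is a finite-dimensional algebra. Every nonzero subcoalgebra of `V` contains a
simple one, hence `1`, so every proper two-sided ideal of the dual lies in the image of `𝔪`. In an
Artinian ring such an ideal is contained in the Jacobson radical, so it is nilpotent
(`exists_pow_le_of_finite_quotient`).

Freeness of `R` over `B` (`free_of_isBraidedLeftCoidealSubalgebra`) is a socle argument for Hopf
modules. Given a `B`-submodule `F` of `R` that is a left coideal, consider the elements `x` with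
`Δ x ≡ 1 ⊗ x` modulo `R ⊗ F`. They satisfy `Δ (b x) ≡ b⁽¹⁾ ⊗ b⁽²⁾ x`, so contracting a
`B`-linear relation among them modulo `F` by a functional in `𝔪` gives a relation whose coefficients
have lower degree; hence linear independence over `k` implies linear independence over `B`
(`linearIndepOn_mkQ_of_coinvariantsMod`). The `B`-module generated by these elements is again a left
coideal. Iterating from `0` gives an exhaustive filtration of `R` with free layers.

For the antipode `S` of `L` (`bijective_antipode_bosonization`), consider linear maps from `L` to the
opposite algebra, under convolution. The identity, composed on either side with the map
`r # h ↦ ε r S⁻¹ h`, gives a map that agrees with the unit on `1 # H`. A map vanishing on `1 # H` is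
locally nilpotent by the filtration of `R` (`locally_nilpotent_of_inr_eq_zero`), so the geometric
series shows that the identity is convolution invertible. Its inverse is a composition inverse of
`S` (`bijective_antipode_of_isUnit_opConv`).
-/

/-! ### Slices of tensors -/

section Slices

open TensorProduct

variable {k V W : Type*} [Field k] [AddCommGroup V] [Module k V] [AddCommGroup W] [Module k W]

/-- The slice map `v ⊗ w ↦ f v • w` of a functional `f` on the left factor. -/
noncomputable def leftSlice (f : V →ₗ[k] k) : V ⊗[k] W →ₗ[k] W :=
  (TensorProduct.lid k W).toLinearMap ∘ₗ f.rTensor W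

/-- The slice map `v ⊗ w ↦ f w • v` of a functional `f` on the right factor. -/
noncomputable def rightSlice (f : W →ₗ[k] k) : V ⊗[k] W →ₗ[k] V :=
  (TensorProduct.rid k V).toLinearMap ∘ₗ f.lTensor V

@[simp]
lemma leftSlice_tmul (f : V →ₗ[k] k) (v : V) (w : W) : leftSlice f (v ⊗ₜ[k] w) = f v • w := by
  simp [leftSlice]

@[simp]
lemma rightSlice_tmul (f : W →ₗ[k] k) (v : V) (w : W) : rightSlice f (v ⊗ₜ[k] w) = f w • v := by
  simp [rightSlice]

lemma leftSlice_comm (f : V →ₗ[k] k) (z : W ⊗[k] V) :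
    leftSlice f (TensorProduct.comm k W V z) = rightSlice f z := by
  induction z with
  | zero => simp
  | add x y hx hy => simp only [map_add, hx, hy]
  | tmul v w => simp

lemma eq_zero_of_leftSlice {z : V ⊗[k] W} (h : ∀ f : V →ₗ[k] k, leftSlice f z = 0) : z = 0 := by
  classical
  let b := Module.Basis.ofVectorSpace k V
  refine (TensorProduct.equivFinsuppOfBasisLeft b).injective (Finsupp.ext fun i => ?_)
  rw [map_zero, Finsupp.zero_apply, ← h (b.coord i)]
  clear h
  induction z with
  | zero => simp
  | add x y hx hy => simp only [map_add, Finsupp.add_apply, hx, hy]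
  | tmul v w => simp [TensorProduct.equivFinsuppOfBasisLeft_apply_tmul]

lemma leftSlice_lTensor {W' : Type*} [AddCommGroup W'] [Module k W'] (f : V →ₗ[k] k)
    (p : W →ₗ[k] W') (z : V ⊗[k] W) : leftSlice f (p.lTensor V z) = p (leftSlice f z) := by
  induction z with
  | zero => simp
  | add x y hx hy => simp only [map_add, hx, hy]
  | tmul v w => simp

/-- A tensor lies in `V ⊗ X` as soon as all its slices lie in `X`. -/
lemma mem_range_lTensor_iff {X : Submodule k W} {z : V ⊗[k] W} :
    z ∈ LinearMap.range (X.subtype.lTensor V) ↔ ∀ f : V →ₗ[k] k, leftSlice f z ∈ X := by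
  constructor
  · rintro ⟨y, rfl⟩ f
    rw [leftSlice_lTensor]
    exact (leftSlice f y).2
  · intro h
    have hex : Function.Exact X.subtype X.mkQ := by
      rw [LinearMap.exact_iff, X.ker_mkQ, X.range_subtype]
    refine (lTensor_exact V hex X.mkQ_surjective z).1 (eq_zero_of_leftSlice fun f => ?_)
    rw [leftSlice_lTensor]
    simpa using h f

lemma mem_range_rTensor_iff {X : Submodule k V} {z : V ⊗[k] W} :
    z ∈ LinearMap.range (X.subtype.rTensor W) ↔ ∀ f : W →ₗ[k] k, rightSlice f z ∈ X := by
  have : z ∈ LinearMap.range (X.subtype.rTensor W) ↔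
      TensorProduct.comm k V W z ∈ LinearMap.range (X.subtype.lTensor W) := by
    constructor
    · rintro ⟨y, rfl⟩
      exact ⟨TensorProduct.comm k X W y, LinearMap.lTensor_comm _ _⟩
    · rintro ⟨y, hy⟩
      refine ⟨(TensorProduct.comm k X W).symm y, (TensorProduct.comm k V W).injective ?_⟩
      rw [← hy]
      obtain ⟨y, rfl⟩ := (TensorProduct.comm k X W).surjective y
      rw [LinearEquiv.symm_apply_apply]
      exact (LinearMap.lTensor_comm _ _).symm
  rw [this, mem_range_lTensor_iff]
  simp only [leftSlice_comm]

end Slices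

/-! ### Contractions of a coalgebra by functionals -/

section Contractions

open TensorProduct Coalgebra WithConv

variable {k C : Type*} [Field k] [AddCommGroup C] [Module k C] [Coalgebra k C]

/-- The map `c ↦ f c₍₁₎ • c₍₂₎`. Functionals are taken in the convolution algebra, of which this is
a right action. -/
noncomputable def leftContract (f : WithConv (C →ₗ[k] k)) : C →ₗ[k] C :=
  leftSlice f.ofConv ∘ₗ comul

/-- The map `c ↦ f c₍₂₎ • c₍₁₎`, a left action of the convolution algebra. -/
noncomputable def rightContract (f : WithConv (C →ₗ[k] k)) : C →ₗ[k] C :=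
  rightSlice f.ofConv ∘ₗ comul

lemma apply_leftContract (f g : WithConv (C →ₗ[k] k)) (c : C) :
    g (leftContract f c) = (f * g) c := by
  rw [LinearMap.convMul_apply, leftContract, LinearMap.comp_apply]
  generalize comul (R := k) c = z
  induction z with
  | zero => simp
  | add x y hx hy => simp only [map_add, hx, hy]
  | tmul v w => simp

lemma apply_rightContract (f g : WithConv (C →ₗ[k] k)) (c : C) :
    f (rightContract g c) = (f * g) c := by
  rw [LinearMap.convMul_apply, rightContract, LinearMap.comp_apply]
  generalize comul (R := k) c = z
  induction z with
  | zero => simp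
  | add x y hx hy => simp only [map_add, hx, hy]
  | tmul v w => simp [mul_comm]

lemma eq_of_forall_functional {x y : C} (h : ∀ f : WithConv (C →ₗ[k] k), f x = f y) : x = y := by
  rw [← sub_eq_zero, ← Module.forall_dual_apply_eq_zero_iff k]
  intro f
  rw [map_sub, sub_eq_zero]
  exact h (toConv f)

lemma leftContract_leftContract (f g : WithConv (C →ₗ[k] k)) (c : C) :
    leftContract g (leftContract f c) = leftContract (f * g) c :=
  eq_of_forall_functional fun h => by
    rw [apply_leftContract, apply_leftContract, apply_leftContract, mul_assoc]

lemma rightContract_rightContract (f g : WithConv (C →ₗ[k] k)) (c : C) :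
    rightContract f (rightContract g c) = rightContract (f * g) c :=
  eq_of_forall_functional fun h => by
    rw [apply_rightContract, apply_rightContract, apply_rightContract, mul_assoc]

lemma leftContract_rightContract (f g : WithConv (C →ₗ[k] k)) (c : C) :
    leftContract f (rightContract g c) = rightContract g (leftContract f c) :=
  eq_of_forall_functional fun h => by
    rw [apply_leftContract, apply_rightContract, apply_rightContract, apply_leftContract,
      mul_assoc]

lemma leftContract_one (c : C) : leftContract (1 : WithConv (C →ₗ[k] k)) c = c :=
  eq_of_forall_functional fun h => by rw [apply_leftContract, one_mul]

lemma rightContract_one (c : C) : rightContract (1 : WithConv (C →ₗ[k] k)) c = c :=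
  eq_of_forall_functional fun h => by rw [apply_rightContract, mul_one]

lemma leftContract_add (f g : WithConv (C →ₗ[k] k)) (c : C) :
    leftContract (f + g) c = leftContract f c + leftContract g c :=
  eq_of_forall_functional fun h => by
    rw [apply_leftContract, add_mul, map_add, apply_leftContract, apply_leftContract]; rfl

lemma leftContract_smul (a : k) (f : WithConv (C →ₗ[k] k)) (c : C) :
    leftContract (a • f) c = a • leftContract f c :=
  eq_of_forall_functional fun h => by
    rw [apply_leftContract, smul_mul_assoc, map_smul, apply_leftContract]; rfl

lemma rightContract_add (f g : WithConv (C →ₗ[k] k)) (c : C) :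
    rightContract (f + g) c = rightContract f c + rightContract g c :=
  eq_of_forall_functional fun h => by
    rw [apply_rightContract, mul_add, map_add, apply_rightContract, apply_rightContract]; rfl

lemma rightContract_smul (a : k) (f : WithConv (C →ₗ[k] k)) (c : C) :
    rightContract (a • f) c = a • rightContract f c :=
  eq_of_forall_functional fun h => by
    rw [apply_rightContract, mul_smul_comm, map_smul, apply_rightContract]; rfl

lemma isLeftCoideal_iff {D : Submodule k C} :
    IsLeftCoideal k D ↔ ∀ (f : WithConv (C →ₗ[k] k)), ∀ d ∈ D, leftContract f d ∈ D := by
  simp only [IsLeftCoideal, mem_range_lTensor_iff]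
  exact ⟨fun h f d hd => h d hd f.ofConv, fun h d hd f => h (toConv f) d hd⟩

/-- A subspace stable under both kinds of contractions is a subcoalgebra. -/
lemma isSubcoalgebra_of_contract {D : Submodule k C}
    (hl : ∀ (f : WithConv (C →ₗ[k] k)), ∀ d ∈ D, leftContract f d ∈ D)
    (hr : ∀ (f : WithConv (C →ₗ[k] k)), ∀ d ∈ D, rightContract f d ∈ D) :
    IsSubcoalgebra D := by
  intro d hd
  obtain ⟨z, hz⟩ := isLeftCoideal_iff.2 hl d hd
  have hz' : z ∈ LinearMap.range (D.subtype.rTensor D) := by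
    refine mem_range_rTensor_iff.2 fun f => ?_
    obtain ⟨g, hg⟩ := LinearMap.exists_extend f
    have : rightSlice f z = rightContract (toConv g) d := by
      rw [rightContract, LinearMap.comp_apply, ← hz, ← hg]
      clear hz
      induction z with
      | zero => simp
      | add x y hx hy => simp only [map_add, hx, hy]
      | tmul v w => simp
    rw [this]
    exact hr _ _ hd
  obtain ⟨y, rfl⟩ := hz'
  refine ⟨y, ?_⟩
  rw [← hz, ← LinearMap.comp_apply, LinearMap.lTensor_comp_rTensor]

lemma finite_range_leftSlice {V W : Type*} [AddCommGroup V] [Module k V] [AddCommGroup W]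
    [Module k W] (z : V ⊗[k] W) :
    ∃ X : Submodule k W, Module.Finite k X ∧ ∀ f : V →ₗ[k] k, leftSlice f z ∈ X := by
  induction z with
  | zero => exact ⟨⊥, inferInstance, fun f => by simp⟩
  | tmul v w =>
    refine ⟨Submodule.span k {w}, inferInstance, fun f => ?_⟩
    rw [leftSlice_tmul]
    exact Submodule.smul_mem _ _ (Submodule.mem_span_singleton_self w)
  | add x y hx hy =>
    obtain ⟨X, hX, hx⟩ := hx
    obtain ⟨Y, hY, hy⟩ := hy
    refine ⟨X ⊔ Y, inferInstance, fun f => ?_⟩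
    rw [map_add]
    exact Submodule.add_mem_sup (hx f) (hy f)

/-- The fundamental theorem of coalgebras: every element lies in a finite-dimensional
subcoalgebra, here in the form of a subspace stable under contractions. -/
lemma exists_finite_subcoalgebra (c : C) : ∃ V : Submodule k C, Module.Finite k V ∧ c ∈ V ∧
    (∀ (f : WithConv (C →ₗ[k] k)), ∀ d ∈ V, leftContract f d ∈ V) ∧
    (∀ (f : WithConv (C →ₗ[k] k)), ∀ d ∈ V, rightContract f d ∈ V) := by
  let S : Set C := {d | ∃ f g : WithConv (C →ₗ[k] k), d = leftContract f (rightContract g c)}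
  have hS : ∃ X : Submodule k C, Module.Finite k X ∧ S ⊆ X := by
    -- the right contractions of `c` lie in the span of a finite set `t`, and the left contractions
    -- of each element `d` of `t` lie in a finite-dimensional space `Y d`
    obtain ⟨X, hX, hc⟩ := finite_range_leftSlice (TensorProduct.comm k C C (comul (R := k) c))
    simp only [leftSlice_comm] at hc
    obtain ⟨t, rfl⟩ := (Submodule.fg_iff_finiteDimensional X).2 hX
    choose Y hY hYt using fun d : C => finite_range_leftSlice (comul (R := k) d)
    refine ⟨⨆ d ∈ t, Y d, ?_, ?_⟩
    · have : ∀ d, Module.Finite k (Y d) := hY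
      rw [← Finset.sup_eq_iSup]
      exact Submodule.finite_finset_sup t Y
    · rintro _ ⟨f, g, rfl⟩
      have h1 : rightContract g c ∈ Submodule.span k (t : Set C) := hc g.ofConv
      have h2 : Submodule.span k (t : Set C) ≤ (⨆ d ∈ t, Y d).comap (leftContract f) :=
        Submodule.span_le.2 fun d hd =>
          (le_iSup₂ (f := fun d (_ : d ∈ t) => Y d) d hd) (hYt d f.ofConv)
      exact h2 h1
  obtain ⟨X, hX, hSX⟩ := hS
  refine ⟨Submodule.span k S, Submodule.finiteDimensional_of_le (Submodule.span_le.2 hSX),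
    Submodule.subset_span ⟨1, 1, by rw [leftContract_one, rightContract_one]⟩, fun h => ?_,
    fun h => ?_⟩
  · refine show Submodule.span k S ≤ (Submodule.span k S).comap (leftContract h) from
      Submodule.span_le.2 ?_
    rintro _ ⟨f, g, rfl⟩
    exact Submodule.subset_span ⟨f * h, g, leftContract_leftContract ..⟩
  · refine show Submodule.span k S ≤ (Submodule.span k S).comap (rightContract h) from
      Submodule.span_le.2 ?_
    rintro _ ⟨f, g, rfl⟩
    refine Submodule.subset_span ⟨f, h * g, ?_⟩
    rw [← leftContract_rightContract, rightContract_rightContract]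

end Contractions

/-! ### Nilpotency of an ideal containing all proper ideals -/

section RingTheory

/-- Let `φ` be a surjection onto a semisimple ring and let `𝔪` be a proper two-sided ideal that
contains every proper two-sided ideal containing the kernel of `φ`. Then `𝔪` lies in the kernel. -/
lemma map_eq_zero_of_mem_of_isSemisimpleRing {A S : Type*} [Ring A] [Ring S] [IsSemisimpleRing S]
    (φ : A →+* S) (hφ : Function.Surjective φ) (m : Ideal A) (hm : m.IsTwoSided)
    (hm1 : m ≠ ⊤)
    (hmax : ∀ Q : Ideal A, Q.IsTwoSided → RingHom.ker φ ≤ Q → Q ≠ ⊤ → Q ≤ m) {a : A}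
    (ha : a ∈ m) : φ a = 0 := by
  let Q : Ideal A :=
    { carrier := {a | ∀ x ∈ m, φ (x * a) = 0}
      add_mem' := fun ha hb x hx => by rw [mul_add, map_add, ha x hx, hb x hx, add_zero]
      zero_mem' := fun x _ => by simp
      smul_mem' := fun c a ha x hx => by
        rw [smul_eq_mul, ← mul_assoc]
        exact ha _ (hm.mul_mem_of_left c hx) }
  have hQ2 : Q.IsTwoSided := ⟨fun b ha x hx => by rw [← mul_assoc, map_mul, ha x hx, zero_mul]⟩
  have hker : RingHom.ker φ ≤ Q := fun a ha x _ => by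
    rw [map_mul, (RingHom.mem_ker).1 ha, mul_zero]
  by_cases hQ : Q = ⊤
  · have h1 : (1 : A) ∈ Q := hQ ▸ Submodule.mem_top
    simpa using h1 a ha
  exfalso
  have hQm := hmax Q hQ2 hker hQ
  -- a left ideal complementary to the image of `m` is annihilated by `m`, hence contained in it
  obtain ⟨c, hc⟩ := exists_isCompl (m.map φ)
  have hcQ : c.comap φ ≤ Q := fun y hy x hx => by
    have h1 : φ (x * y) ∈ m.map φ := Ideal.mem_map_of_mem φ (hm.mul_mem_of_left y hx)
    have h2 : φ (x * y) ∈ c := by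
      rw [map_mul]
      exact c.mul_mem_left _ hy
    exact (Submodule.disjoint_def.1 hc.disjoint) _ h1 h2
  have hcm : c ≤ m.map φ := fun s hs => by
    obtain ⟨y, rfl⟩ := hφ s
    exact Ideal.mem_map_of_mem φ (hQm (hcQ hs))
  have htop : m.map φ = ⊤ := by
    rw [← hc.sup_eq_top, sup_eq_left.2 hcm]
  obtain ⟨x, hx, hx1⟩ := (Ideal.mem_map_iff_of_surjective φ hφ).1
    (htop ▸ Submodule.mem_top : (1 : S) ∈ m.map φ)
  refine hm1 ((Ideal.eq_top_iff_one m).2 ?_)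
  have : x - 1 ∈ RingHom.ker φ := by rw [RingHom.mem_ker, map_sub, hx1, map_one, sub_self]
  have := m.sub_mem hx (hQm (hker this))
  rwa [sub_sub_cancel] at this

/-- If a proper two-sided ideal `𝔪` contains every proper two-sided ideal containing the two-sided
ideal `P` of finite codimension, then a power of `𝔪` is contained in `P`: modulo `P`, it lies in
the Jacobson radical. -/
lemma exists_pow_le_of_finite_quotient {k A : Type*} [Field k] [Ring A] [Algebra k A]
    (P m : Ideal A) [P.IsTwoSided] [Module.Finite k (A ⧸ P)] (hm : m.IsTwoSided) (hm1 : m ≠ ⊤)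
    (hmax : ∀ Q : Ideal A, Q.IsTwoSided → P ≤ Q → Q ≠ ⊤ → Q ≤ m) :
    ∃ n : ℕ, (m.restrictScalars k) ^ n ≤ P.restrictScalars k := by
  have : IsArtinianRing (A ⧸ P) := IsArtinianRing.of_finite k (A ⧸ P)
  obtain ⟨n, hn⟩ := IsSemiprimaryRing.isNilpotent (R := A ⧸ P)
  have hmJ (a : A) (ha : a ∈ m) : Ideal.Quotient.mk P a ∈ Ring.jacobson (A ⧸ P) := by
    have h1 := map_eq_zero_of_mem_of_isSemisimpleRing
      ((Ideal.Quotient.mk (Ring.jacobson (A ⧸ P))).comp (Ideal.Quotient.mk P))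
      (Ideal.Quotient.mk_surjective.comp Ideal.Quotient.mk_surjective) m hm hm1
      (fun Q hQ hP => hmax Q hQ fun a ha => hP (by
        rw [RingHom.mem_ker, RingHom.comp_apply, Ideal.Quotient.eq_zero_iff_mem.2 ha, map_zero]))
      ha
    exact Ideal.Quotient.eq_zero_iff_mem.1 h1
  have hpow (i : ℕ) : ∀ a ∈ (m.restrictScalars k) ^ i,
      Ideal.Quotient.mk P a ∈ Ring.jacobson (A ⧸ P) ^ i := by
    induction i with
    | zero => intro a _; rw [Submodule.pow_zero, Ideal.one_eq_top]; exact Submodule.mem_top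
    | succ i ih =>
      intro a ha
      rw [Submodule.pow_succ] at ha
      refine Submodule.mul_induction_on ha (fun x hx y hy => ?_) fun x y hx hy => ?_
      · rw [map_mul, Submodule.pow_succ]
        exact Ideal.mul_mem_mul (ih x hx) (hmJ y hy)
      · rw [map_add]
        exact Ideal.add_mem _ hx hy
  refine ⟨n, fun a ha => Ideal.Quotient.eq_zero_iff_mem.1 ?_⟩
  have := hpow n a ha
  rw [hn] at this
  simpa using this

end RingTheory

/-! ### The filtration of a connected coalgebra -/

section Filtration

open TensorProduct Coalgebra WithConv

variable {k C : Type*} [Field k] [AddCommGroup C] [Module k C] [Coalgebra k C]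

/-- Evaluation at a group-like element, a character of the convolution algebra. -/
noncomputable def evalGroupLike {e : C} (he : IsGroupLikeElem k e) :
    WithConv (C →ₗ[k] k) →+* k where
  toFun f := f e
  map_one' := by simp [he.counit_eq_one]
  map_mul' f g := by simp [he.comul_eq_tmul_self]
  map_zero' := rfl
  map_add' f g := rfl

/-- The functionals vanishing at a group-like element, as a subspace of the convolution
algebra. -/
noncomputable def vanishing {e : C} (he : IsGroupLikeElem k e) :
    Submodule k (WithConv (C →ₗ[k] k)) :=
  (RingHom.ker (evalGroupLike he)).restrictScalars k

lemma mem_vanishing {e : C} {he : IsGroupLikeElem k e} {f : WithConv (C →ₗ[k] k)} :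
    f ∈ vanishing he ↔ f e = 0 := Iff.rfl

/-- The filtration of a coalgebra by the subspaces orthogonal to the powers of the ideal of
functionals vanishing at a group-like element; its first term is the line spanned by that
element. -/
noncomputable def groupLikeFiltration {e : C} (he : IsGroupLikeElem k e) (n : ℕ) :
    Submodule k C where
  carrier := {c | ∀ f ∈ vanishing he ^ (n + 1), f c = 0}
  add_mem' hx hy f hf := by rw [map_add, hx f hf, hy f hf, add_zero]
  zero_mem' f _ := map_zero f.ofConv
  smul_mem' a x hx f hf := by rw [map_smul, hx f hf, smul_zero]

variable {e : C} {he : IsGroupLikeElem k e}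

lemma sub_smul_one_mem_vanishing (he : IsGroupLikeElem k e) (f : WithConv (C →ₗ[k] k)) :
    f - f e • 1 ∈ vanishing he := by
  rw [mem_vanishing, ofConv_sub, ofConv_smul, LinearMap.sub_apply, LinearMap.smul_apply,
    LinearMap.convOne_apply, he.counit_eq_one]
  simp

/-- An element killed by the functionals that vanish at `e` is a multiple of `e`. -/
lemma eq_smul_of_vanishing (he : IsGroupLikeElem k e) {c : C}
    (hc : ∀ f ∈ vanishing he, f c = 0) : c = counit (R := k) c • e := by
  refine eq_of_forall_functional (k := k) fun f => ?_
  have h1 := hc _ (sub_smul_one_mem_vanishing he f)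
  rw [ofConv_sub, ofConv_smul, LinearMap.sub_apply, LinearMap.smul_apply,
      LinearMap.convOne_apply, sub_eq_zero] at h1
  rw [h1, map_smul]
  simp [mul_comm]

lemma leftContract_groupLike (he : IsGroupLikeElem k e) (f : WithConv (C →ₗ[k] k)) :
    leftContract f e = f e • e := by
  simp [leftContract, he.comul_eq_tmul_self]

/-- An element annihilated by the left contractions with functionals vanishing at `e` is a
multiple of `e`. -/
lemma eq_smul_of_leftContract (he : IsGroupLikeElem k e) {c : C}
    (hc : ∀ f ∈ vanishing he, leftContract f c = 0) : c = counit (R := k) c • e := by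
  refine eq_smul_of_vanishing he fun f hf => ?_
  rw [← mul_one f, ← apply_leftContract, hc f hf, map_zero]

lemma eq_smul_of_mem_groupLikeFiltration_zero {c : C} (hc : c ∈ groupLikeFiltration he 0) :
    c = counit (R := k) c • e :=
  eq_smul_of_vanishing he fun f hf => hc f (by rwa [zero_add, Submodule.pow_one])

lemma leftContract_mem_groupLikeFiltration {n : ℕ} {c : C}
    (hc : c ∈ groupLikeFiltration he (n + 1)) {f : WithConv (C →ₗ[k] k)} (hf : f ∈ vanishing he) :
    leftContract f c ∈ groupLikeFiltration he n := fun g hg => by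
  rw [apply_leftContract]
  refine hc _ ?_
  rw [Submodule.pow_succ' _ n.succ_ne_zero]
  exact Submodule.mul_mem_mul hf hg

lemma rightContract_mem_groupLikeFiltration {n : ℕ} {c : C}
    (hc : c ∈ groupLikeFiltration he (n + 1)) {f : WithConv (C →ₗ[k] k)} (hf : f ∈ vanishing he) :
    rightContract f c ∈ groupLikeFiltration he n := fun g hg => by
  rw [apply_rightContract]
  refine hc _ ?_
  rw [Submodule.pow_succ]
  exact Submodule.mul_mem_mul hg hf

/-- If every nonzero finite-dimensional subcoalgebra contains the group-like element `e`, then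
the filtration attached to `e` is exhaustive. The functionals vanishing on a finite-dimensional
subcoalgebra `V` form an ideal `P` of finite codimension, and the proper two-sided ideals above
`P` correspond to the nonzero subcoalgebras of `V`, so they all vanish at `e`. -/
lemma exists_mem_groupLikeFiltration (he : IsGroupLikeElem k e)
    (hconn : ∀ D : Submodule k C, Module.Finite k D → IsSubcoalgebra D → D ≠ ⊥ → e ∈ D) (c : C) :
    ∃ n, c ∈ groupLikeFiltration he n := by
  obtain ⟨V, hVfin, hcV, hVl, hVr⟩ := exists_finite_subcoalgebra (k := k) c
  let P : Ideal (WithConv (C →ₗ[k] k)) :=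
    { carrier := {f | ∀ v ∈ V, f v = 0}
      add_mem' := fun {f g} hf hg v hv => by
        rw [ofConv_add, LinearMap.add_apply, hf v hv, hg v hv, add_zero]
      zero_mem' := fun v _ => rfl
      smul_mem' := fun g f hf v hv => by
        rw [smul_eq_mul, ← apply_leftContract]
        exact hf _ (hVl g v hv) }
  have hP2 : P.IsTwoSided := ⟨fun {f} g hf v hv => by
    rw [← apply_rightContract]
    exact hf _ (hVr g v hv)⟩
  -- restriction of functionals to `V` has kernel `P`
  let res : WithConv (C →ₗ[k] k) →ₗ[k] Module.Dual k V :=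
    V.subtype.dualMap ∘ₗ (WithConv.linearEquiv k (C →ₗ[k] k)).toLinearMap
  have hresker (f : WithConv (C →ₗ[k] k)) : res f = 0 ↔ f ∈ P :=
    ⟨fun h v hv => LinearMap.congr_fun h ⟨v, hv⟩, fun h => LinearMap.ext fun v => h v v.2⟩
  have hfin : Module.Finite k (WithConv (C →ₗ[k] k) ⧸ P) := by
    have h1 : P.restrictScalars k = LinearMap.ker res := by
      ext f
      exact (hresker f).symm
    have h2 : Module.Finite k (WithConv (C →ₗ[k] k) ⧸ LinearMap.ker res) :=
      Module.Finite.equiv res.quotKerEquivRange.symm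
    rw [← h1] at h2
    exact h2
  have hmax : ∀ Q : Ideal (WithConv (C →ₗ[k] k)), Q.IsTwoSided → P ≤ Q → Q ≠ ⊤ →
      Q ≤ RingHom.ker (evalGroupLike he) := by
    intro Q hQ2 hPQ hQ f hf
    let D0 : Submodule k V := ((Q.restrictScalars k).map res).dualCoannihilator
    have hD0 (v : V) : v ∈ D0 ↔ ∀ f ∈ Q, f (v : C) = 0 := by
      rw [Submodule.mem_dualCoannihilator]
      exact ⟨fun h f hf => h (res f) ⟨f, hf, rfl⟩, by rintro h _ ⟨f, hf, rfl⟩; exact h f hf⟩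
    have hmem (v : C) : v ∈ D0.map V.subtype ↔ v ∈ V ∧ ∀ f ∈ Q, f v = 0 := by
      constructor
      · rintro ⟨v, hv, rfl⟩
        exact ⟨v.2, (hD0 v).1 hv⟩
      · rintro ⟨hv, h⟩
        exact ⟨⟨v, hv⟩, (hD0 _).2 h, rfl⟩
    refine ((hmem e).1 (hconn (D0.map V.subtype) inferInstance ?_ ?_)).2 f hf
    · refine isSubcoalgebra_of_contract (fun g v hv => ?_) (fun g v hv => ?_)
      · rw [hmem] at hv ⊢
        refine ⟨hVl g v hv.1, fun f hf => ?_⟩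
        rw [apply_leftContract]
        exact hv.2 _ (Q.mul_mem_left g hf)
      · rw [hmem] at hv ⊢
        refine ⟨hVr g v hv.1, fun f hf => ?_⟩
        rw [apply_rightContract]
        exact hv.2 _ (hQ2.mul_mem_of_left g hf)
    · intro hbot
      have h0 : D0 = ⊥ := (Submodule.eq_bot_iff D0).2 fun v hv =>
        Subtype.ext ((Submodule.mem_bot k).1
          (hbot ▸ ⟨v, hv, rfl⟩ : (v : C) ∈ (⊥ : Submodule k C)))
      have h1 := Subspace.dualCoannihilator_dualAnnihilator_eq
        (W := (Q.restrictScalars k).map res)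
      rw [show ((Q.restrictScalars k).map res).dualCoannihilator = ⊥ from h0,
        Submodule.dualAnnihilator_bot] at h1
      obtain ⟨f, hf, hf1⟩ := h1 ▸ Submodule.mem_top (x := res 1)
      refine hQ ((Ideal.eq_top_iff_one Q).2 ?_)
      have : f - 1 ∈ Q := hPQ ((hresker _).1 (by rw [map_sub, hf1, sub_self]))
      have := Q.sub_mem hf this
      rwa [sub_sub_cancel] at this
  obtain ⟨n, hn⟩ := exists_pow_le_of_finite_quotient (k := k) P (RingHom.ker (evalGroupLike he))
    inferInstance (RingHom.ker_ne_top _) hmax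
  have hle : vanishing he ^ (n + 1) ≤ P.restrictScalars k := by
    rw [Submodule.pow_succ]
    exact Submodule.mul_le.2 fun x hx y _ => hP2.mul_mem_of_left y (hn hx)
  exact ⟨n, fun f hf => hle hf c hcV⟩

/-- A nonzero finite-dimensional subcoalgebra contains a simple subcoalgebra. -/
lemma exists_isSimpleSubcoalgebra_le {D : Submodule k C} (hfin : Module.Finite k D)
    (hD : IsSubcoalgebra D) (hne : D ≠ ⊥) : ∃ E ≤ D, IsSimpleSubcoalgebra E := by
  obtain ⟨n, hn⟩ : ∃ n, Module.finrank k D = n := ⟨_, rfl⟩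
  induction n using Nat.strong_induction_on generalizing D with
  | _ n ih =>
    by_cases hs : ∀ E ≤ D, IsSubcoalgebra E → E = ⊥ ∨ E = D
    · exact ⟨D, le_rfl, hD, hne, hs⟩
    push Not at hs
    obtain ⟨E, hED, hE, hE0, hE1⟩ := hs
    have hlt := Submodule.finrank_lt_finrank_of_lt (lt_of_le_of_ne hED hE1)
    obtain ⟨F, hFE, hF⟩ := ih _ (hn ▸ hlt) (Submodule.finiteDimensional_of_le hED) hE hE0 rfl
    exact ⟨F, hFE.trans hED, hF⟩

/-- In a connected coalgebra, every nonzero finite-dimensional subcoalgebra contains the unit. -/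
lemma one_mem_of_isConnectedCoalgebra {R : Type*} [Ring R] [Algebra k R] [Coalgebra k R]
    (hR : IsConnectedCoalgebra k R) (D : Submodule k R) (hfin : Module.Finite k D)
    (hD : IsSubcoalgebra D) (hne : D ≠ ⊥) : (1 : R) ∈ D := by
  obtain ⟨E, hED, hE⟩ := exists_isSimpleSubcoalgebra_le hfin hD hne
  have h1 : E ≤ Submodule.span k {1} := hR ▸ le_sSup (a := E) hE
  obtain ⟨x, hx, hx0⟩ := Submodule.exists_mem_ne_zero_of_ne_bot hE.2.1
  obtain ⟨a, rfl⟩ := Submodule.mem_span_singleton.1 (h1 hx)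
  have ha : a ≠ 0 := fun h => hx0 (by rw [h, zero_smul])
  have := E.smul_mem a⁻¹ hx
  rw [smul_smul, inv_mul_cancel₀ ha, one_smul] at this
  exact hED this

lemma groupLikeFiltration_mono {e : C} (he : IsGroupLikeElem k e) :
    Monotone (groupLikeFiltration he) := by
  refine monotone_nat_of_le_succ fun n c hc f hf => hc f ?_
  have h1 : vanishing he * vanishing he ≤ vanishing he := Submodule.mul_le.2 fun x hx y hy => by
    rw [mem_vanishing] at hx
    exact ((map_mul (evalGroupLike he) x y).trans (by
      rw [show evalGroupLike he x = 0 from hx, zero_mul]) : evalGroupLike he (x * y) = 0)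
  rw [Submodule.pow_succ, Submodule.pow_succ] at hf
  rw [Submodule.pow_succ]
  refine (Submodule.mul_le.2 fun x hx y hy => ?_) hf
  refine Submodule.mul_induction_on hx (fun p hp q hq => ?_) fun p q hp hq => ?_
  · rw [mul_assoc]
    exact Submodule.mul_mem_mul hp (h1 (Submodule.mul_mem_mul hq hy))
  · rw [add_mul]
    exact Submodule.add_mem _ hp hq

end Filtration

lemma BraidedHopfAlgebra.isGroupLikeElem_one (k H R : Type*) [Field k] [Ring H] [HopfAlgebra k H]
    [Ring R] [Algebra k R] [Coalgebra k R] [BraidedHopfAlgebra k H R] :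
    IsGroupLikeElem k (1 : R) where
  counit_eq_one := BraidedHopfAlgebra.counit_one (H := H)
  comul_eq_tmul_self := BraidedHopfAlgebra.comul_one (H := H)

/-! ### Freeness of a filtered module -/

/-- A module with an exhaustive filtration is free if each layer `F (n + 1) / F n` has a basis
consisting of the classes of a set `t n`. -/
lemma Module.Free.of_filtration {A M : Type*} [Ring A] [AddCommGroup M] [Module A M]
    (F : ℕ → Submodule A M) (t : ℕ → Set M) (h0 : F 0 = ⊥) (hmono : ∀ n, F n ≤ F (n + 1))
    (ht : ∀ n, t n ⊆ F (n + 1)) (hli : ∀ n, LinearIndepOn A (F n).mkQ (t n))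
    (hspan : ∀ n, F (n + 1) ≤ F n ⊔ Submodule.span A (t n)) (hex : ∀ x, ∃ n, x ∈ F n) :
    Module.Free A M := by
  let S : ℕ → Set M := fun n => Nat.rec ∅ (fun n s => s ∪ t n) n
  have hS (n : ℕ) : S (n + 1) = S n ∪ t n := rfl
  have hSF (n : ℕ) : S n ⊆ F n := by
    induction n with
    | zero => exact Set.empty_subset _
    | succ n ih =>
      rw [hS]
      exact Set.union_subset (ih.trans (hmono n)) (ht n)
  have hSli (n : ℕ) : LinearIndepOn A id (S n) := by
    induction n with
    | zero => exact linearIndepOn_empty A id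
    | succ n ih => exact ih.union_id_of_quotient (hSF n) (hli n)
  have hSmono : Monotone S := monotone_nat_of_le_succ fun n => Set.subset_union_left
  have hSspan (n : ℕ) : F n ≤ Submodule.span A (S n) := by
    induction n with
    | zero => rw [h0]; exact bot_le
    | succ n ih =>
      refine (hspan n).trans (sup_le (ih.trans ?_) ?_)
      · exact Submodule.span_mono (hSmono n.le_succ)
      · exact Submodule.span_mono Set.subset_union_right
  have hli' : LinearIndepOn A id (⋃ n, S n) :=
    linearIndepOn_iUnion_of_directed hSmono.directed_le hSli
  refine Module.Free.of_basis (Module.Basis.mk hli' fun x _ => ?_)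
  obtain ⟨n, hn⟩ := hex x
  rw [show Set.range (fun y : ↥(⋃ n, S n) => id (y : M)) = ⋃ n, S n from Subtype.range_coe]
  exact Submodule.span_mono (Set.subset_iUnion S n) (hSspan n hn)

/-! ### A connected braided Hopf algebra is free over its left coideal subalgebras -/

section BraidedFreeness

open TensorProduct Coalgebra WithConv YetterDrinfeld

variable {k H R : Type*} [Field k] [Ring H] [HopfAlgebra k H] [Ring R] [Algebra k R]
  [Coalgebra k R] [BraidedHopfAlgebra k H R]

/-- The product in `R ⊗ R` of `R ⊗ B` and `R ⊗ F` lies in `R ⊗ F` if `F` is a left `B`-module. The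
braiding moves an `H`-coefficient of an element of `B` past an element of `R`, and leaves a
component in the `H`-subcomodule `B`. -/
lemma braidedMul_mem_range_lTensor {B : Subalgebra k R}
    (hB : IsSubcomodule H (Subalgebra.toSubmodule B)) {F : Submodule k R}
    (hF : ∀ b ∈ B, ∀ x ∈ F, b * x ∈ F) {u t : R ⊗[k] R}
    (hu : u ∈ LinearMap.range ((Subalgebra.toSubmodule B).subtype.lTensor R))
    (ht : t ∈ LinearMap.range (F.subtype.lTensor R)) :
    braidedMul k H R (u ⊗ₜ t) ∈ LinearMap.range (F.subtype.lTensor R) := by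
  obtain ⟨u, rfl⟩ := hu
  obtain ⟨t, rfl⟩ := ht
  induction u with
  | zero => simp
  | add x y hx hy =>
    rw [map_add, add_tmul, map_add]
    exact Submodule.add_mem _ hx hy
  | tmul a b =>
    induction t with
    | zero => simp
    | add x y hx hy =>
      rw [map_add, tmul_add, map_add]
      exact Submodule.add_mem _ hx hy
    | tmul c d =>
      rw [LinearMap.lTensor_tmul, LinearMap.lTensor_tmul, Bosonization.braidedMul_tmul]
      obtain ⟨y, hy⟩ := hB b b.2
      change map _ _ (coact (b : R)) ∈ _
      rw [← hy]
      clear hy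
      induction y with
      | zero => simp
      | add x y hx hy =>
        rw [map_add, map_add]
        exact Submodule.add_mem _ hx hy
      | tmul h b' => exact ⟨(a * act (k := k) h c) ⊗ₜ ⟨b' * d, hF b' b'.2 d d.2⟩, by simp⟩

lemma braidedMul_one_tmul (u : R ⊗[k] R) (x : R) :
    braidedMul k H R (u ⊗ₜ (1 ⊗ₜ x)) = (LinearMap.mulRight k x).lTensor R u := by
  induction u with
  | zero => simp
  | add y z hy hz => rw [add_tmul, map_add, map_add, hy, hz]
  | tmul a b =>
    have h1 (y : H ⊗[k] R) :
        map (LinearMap.mulLeft k a ∘ₗ (act : H →ₐ[k] Module.End k R).toLinearMap.flip 1)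
          (LinearMap.mulRight k x) y =
        map (LinearMap.toSpanSingleton k R a) (LinearMap.mulRight k x)
          (counit.rTensor R y) := by
      induction y with
      | zero => simp
      | add y z hy hz => simp only [map_add, hy, hz]
      | tmul h r => simp [BraidedHopfAlgebra.act_one]
    rw [Bosonization.braidedMul_tmul, h1, counit_coact]
    simp

/-- Multiplication by an element `x` that is coinvariant modulo `F` commutes with contractions
modulo `F`. -/
lemma leftContract_mul_sub_mem {B : Subalgebra k R} (hB : IsBraidedLeftCoidealSubalgebra H B)
    {F : Submodule k R} (hF : ∀ b ∈ B, ∀ x ∈ F, b * x ∈ F) {x : R}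
    (hx : comul (R := k) x - 1 ⊗ₜ x ∈ LinearMap.range (F.subtype.lTensor R))
    (f : WithConv (R →ₗ[k] k)) {b : R} (hb : b ∈ B) :
    leftContract f (b * x) - leftContract f b * x ∈ F := by
  have h1 := braidedMul_mem_range_lTensor hB.1 hF (hB.2 b hb) hx
  rw [tmul_sub, map_sub, ← BraidedHopfAlgebra.comul_mul, braidedMul_one_tmul] at h1
  have h2 := mem_range_lTensor_iff.1 h1 f.ofConv
  rwa [map_sub, leftSlice_lTensor] at h2

/-- The elements `r` coinvariant modulo `F`, that is, `Δ r ≡ e ⊗ r` modulo `R ⊗ F`. This is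
expressed by contractions with the functionals that vanish at `e`. -/
noncomputable def coinvariantsMod {e : R} (he : IsGroupLikeElem k e) (F : Submodule k R) :
    Submodule k R where
  carrier := {r | ∀ f ∈ vanishing he, leftContract f r ∈ F}
  add_mem' hx hy f hf := by
    rw [map_add]
    exact F.add_mem (hx f hf) (hy f hf)
  zero_mem' f _ := by
    rw [map_zero]
    exact F.zero_mem
  smul_mem' a x hx f hf := by
    rw [map_smul]
    exact F.smul_mem a (hx f hf)

lemma comul_sub_mem_of_mem_coinvariantsMod {e : R} {he : IsGroupLikeElem k e}
    {F : Submodule k R} {x : R} (hx : x ∈ coinvariantsMod he F) :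
    comul (R := k) x - e ⊗ₜ x ∈ LinearMap.range (F.subtype.lTensor R) := by
  refine mem_range_lTensor_iff.2 fun f => ?_
  have h2 := hx _ (sub_smul_one_mem_vanishing he (toConv f))
  rw [sub_eq_add_neg, ← neg_smul, leftContract_add, leftContract_smul, leftContract_one,
    neg_smul, ← sub_eq_add_neg] at h2
  rw [map_sub, leftSlice_tmul]
  exact h2

/-- If a subset of the elements coinvariant modulo `F` is linearly independent over `k` modulo
`F`, then it is so over the left coideal subalgebra `B`: contractions lower the filtration degree
of the coefficients of a relation, until they are scalars. -/
lemma linearIndepOn_mkQ_of_coinvariantsMod {B : Subalgebra k R}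
    (hB : IsBraidedLeftCoidealSubalgebra H B) (he : IsGroupLikeElem k (1 : R))
    (hex : ∀ r : R, ∃ n, r ∈ groupLikeFiltration he n) (F : Submodule B R)
    (hF : ∀ (f : WithConv (R →ₗ[k] k)), ∀ x ∈ F, leftContract f x ∈ F) {t : Set R}
    (ht : t ⊆ coinvariantsMod he (F.restrictScalars k))
    (hli : LinearIndepOn k (F.restrictScalars k).mkQ t) : LinearIndepOn B F.mkQ t := by
  -- a relation with scalar coefficients is trivial by assumption
  have hscalar (l : t →₀ B) (hl : ∀ i, (l i : R) = counit (R := k) (l i : R) • 1)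
      (hsum : (l.sum fun i b => (b : R) * i) ∈ F) : l = 0 := by
    let l' : t →₀ k := l.mapRange (fun b : B => counit (R := k) (b : R)) (by simp)
    have h1 : l' = 0 := by
      refine (linearIndependent_iff.1 hli) l' ?_
      have h2 : Finsupp.linearCombination k (fun i : t => (F.restrictScalars k).mkQ i) l' =
          (F.restrictScalars k).mkQ (l.sum fun i b => (b : R) * i) := by
        rw [Finsupp.linearCombination_apply, Finsupp.sum_mapRange_index (by simp), map_finsuppSum]
        refine Finsupp.sum_congr fun i _ => ?_
        conv_rhs => rw [hl i, smul_mul_assoc, one_mul, map_smul]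
      rw [h2]
      exact (Submodule.Quotient.mk_eq_zero _).2 hsum
    ext i
    have h2 : counit (R := k) (l i : R) = 0 := DFunLike.congr_fun h1 i
    rw [hl i, h2]
    simp
  have hmain (n : ℕ) : ∀ l : t →₀ B, (∀ i, (l i : R) ∈ groupLikeFiltration he n) →
      (l.sum fun i b => (b : R) * i) ∈ F → l = 0 := by
    induction n with
    | zero => exact fun l hl hsum =>
        hscalar l (fun i => eq_smul_of_mem_groupLikeFiltration_zero (hl i)) hsum
    | succ n ih =>
      intro l hl hsum
      refine hscalar l (fun i => eq_smul_of_leftContract he fun f hf => ?_) hsum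
      -- contracting the coefficients gives a relation of lower degree, hence a trivial one
      let φ : B → B := fun b => ⟨leftContract f b, isLeftCoideal_iff.1 hB.2 f b b.2⟩
      have hφ0 : φ 0 = 0 := Subtype.ext (map_zero (leftContract f))
      have h1 : l.mapRange φ hφ0 = 0 := by
        refine ih _ (fun i => leftContract_mem_groupLikeFiltration (hl i) hf) ?_
        rw [Finsupp.sum_mapRange_index (by simp)]
        have h2 : (l.sum fun i b => leftContract f ((b : R) * i) - leftContract f (b : R) * i) ∈
            F :=
          Submodule.sum_mem _ fun i _ => leftContract_mul_sub_mem (F := F.restrictScalars k) hB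
            (fun b hb x hx => F.smul_mem ⟨b, hb⟩ hx)
            (comul_sub_mem_of_mem_coinvariantsMod (ht i.2)) f (l i).2
        have h3 := hF f _ hsum
        rw [map_finsuppSum] at h3
        rw [Finsupp.sum_sub] at h2
        have := F.sub_mem h3 h2
        rwa [sub_sub_cancel] at this
      exact congrArg Subtype.val (DFunLike.congr_fun h1 i)
  refine linearIndependent_iff.2 fun l hl => ?_
  choose N hN using hex
  refine hmain (l.support.sup fun i => N (l i)) l (fun i => ?_) ?_
  · by_cases hi : i ∈ l.support
    · exact groupLikeFiltration_mono he (Finset.le_sup (f := fun i => N (l i)) hi) (hN _)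
    · rw [Finsupp.notMem_support_iff.1 hi]
      exact Submodule.zero_mem _
  · refine (Submodule.Quotient.mk_eq_zero F).1 (Eq.trans ?_ hl)
    rw [Finsupp.linearCombination_apply, ← Submodule.mkQ_apply, map_finsuppSum]
    rfl

/-- A connected braided Hopf algebra is free as a left module over every left coideal subalgebra
`B`. The filtration `F` is such that `F (n + 1)` is the `B`-submodule generated by the elements
that are coinvariant modulo `F n`. -/
lemma free_of_isBraidedLeftCoidealSubalgebra (hR : IsConnectedCoalgebra k R) {B : Subalgebra k R}
    (hB : IsBraidedLeftCoidealSubalgebra H B) : Module.Free B R := by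
  have he := BraidedHopfAlgebra.isGroupLikeElem_one k H R
  have hex := exists_mem_groupLikeFiltration he (one_mem_of_isConnectedCoalgebra hR)
  let F : ℕ → Submodule B R := fun n =>
    Nat.rec ⊥ (fun _ F => Submodule.span B (coinvariantsMod he (F.restrictScalars k))) n
  have hFs (n : ℕ) : F (n + 1) =
    Submodule.span B (coinvariantsMod he ((F n).restrictScalars k)) := rfl
  -- each `F n` is a left coideal
  have hFc (n : ℕ) : ∀ (f : WithConv (R →ₗ[k] k)), ∀ x ∈ F n, leftContract f x ∈ F n := by
    induction n with
    | zero =>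
      intro f x hx
      rw [(Submodule.mem_bot B).1 hx, map_zero]
      exact Submodule.zero_mem _
    | succ n ih =>
      -- the factor `b` makes the claim stable under the action of `B`
      have h1 : ∀ x ∈ F (n + 1), ∀ b : B, ∀ (f : WithConv (R →ₗ[k] k)),
          leftContract f (b • x) ∈ F (n + 1) := by
        intro x hx
        induction hx using Submodule.span_induction with
        | zero =>
          intro b f
          rw [smul_zero, map_zero]
          exact Submodule.zero_mem _
        | add x y _ _ hx hy =>
          intro b f
          rw [smul_add, map_add]
          exact Submodule.add_mem _ (hx b f) (hy b f)
        | smul c x _ hx =>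
          intro b f
          rw [smul_smul]
          exact hx _ f
        | mem x hx =>
          intro b f
          have h2 := leftContract_mul_sub_mem (F := (F n).restrictScalars k) hB
            (fun b hb x hx => (F n).smul_mem ⟨b, hb⟩ hx)
            (comul_sub_mem_of_mem_coinvariantsMod hx) f b.2
          have h3 : leftContract f (b : R) * x ∈ F (n + 1) :=
            (F (n + 1)).smul_mem ⟨_, isLeftCoideal_iff.1 hB.2 f b b.2⟩ (Submodule.subset_span hx)
          have h4 : leftContract f ((b : R) * x) - leftContract f (b : R) * x ∈ F (n + 1) :=
            Submodule.subset_span fun g _ => ih g _ h2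
          have := Submodule.add_mem _ h4 h3
          rwa [sub_add_cancel] at this
      intro f x hx
      have := h1 x hx 1 f
      rwa [one_smul] at this
  have hFmono (n : ℕ) : F n ≤ F (n + 1) := fun x hx =>
    Submodule.subset_span fun f _ => hFc n f x hx
  choose t ht _ htspan htli using fun n => exists_linearIndepOn_extension
    (linearIndepOn_empty k ((F n).restrictScalars k).mkQ)
    (Set.empty_subset (coinvariantsMod he ((F n).restrictScalars k) : Set R))
  refine Module.Free.of_filtration F t rfl hFmono (fun n => (ht n).trans Submodule.subset_span)
    (fun n => linearIndepOn_mkQ_of_coinvariantsMod hB he hex (F n) (hFc n) (ht n) (htli n))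
    (fun n => ?_) (fun r => ?_)
  · refine Submodule.span_le.2 fun x hx => ?_
    have h1 := htspan n ⟨x, hx, rfl⟩
    rw [← Submodule.map_span] at h1
    obtain ⟨y, hy, hxy⟩ := h1
    have h2 : x - y ∈ F n := (Submodule.Quotient.eq _).1 hxy.symm
    have h3 : y ∈ Submodule.span B (t n) :=
      Submodule.span_le_restrictScalars k B (t n) hy
    have := Submodule.add_mem_sup h2 h3
    rwa [sub_add_cancel] at this
  · obtain ⟨n, hn⟩ := hex r
    have hU (n : ℕ) : ∀ r ∈ groupLikeFiltration he n, r ∈ F (n + 1) := by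
      induction n with
      | zero =>
        intro r hr
        refine Submodule.subset_span fun f hf => ?_
        rw [eq_smul_of_mem_groupLikeFiltration_zero hr, map_smul, leftContract_groupLike he,
          mem_vanishing.1 hf, zero_smul, smul_zero]
        exact Submodule.zero_mem _
      | succ n ih =>
        exact fun r hr => Submodule.subset_span fun f hf =>
          ih _ (leftContract_mem_groupLikeFiltration hr hf)
    exact ⟨n + 1, hU n r hn⟩

end BraidedFreeness

/-! ### Convolution inverses -/

section Convolution

open TensorProduct Coalgebra WithConv

variable {k C A : Type*} [Field k] [AddCommGroup C] [Module k C] [Coalgebra k C] [Ring A]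
  [Algebra k A]

/-- If every element is killed by all large convolution powers of `u`, then `1 - u` is invertible
for convolution: the geometric series converges pointwise. -/
lemma isUnit_one_sub_of_locally_nilpotent (u : WithConv (C →ₗ[k] A))
    (hu : ∀ x : C, ∃ n, ∀ m, n ≤ m → (u ^ m) x = 0) : IsUnit (1 - u) := by
  choose N hN using hu
  -- `s n` are the partial sums of the geometric series, stationary at `x` from `N x` on
  let s : ℕ → WithConv (C →ₗ[k] A) := fun n => ∑ i ∈ Finset.range n, u ^ i
  have hs1 (n : ℕ) (x : C) : s (n + 1) x = s n x + (u ^ n) x := by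
    simp only [s, Finset.sum_range_succ]
    rfl
  have hs (x : C) (n : ℕ) (hn : N x ≤ n) : s n x = s (N x) x := by
    induction n, hn using Nat.le_induction with
    | base => rfl
    | succ n hn ih => rw [hs1, hN x n hn, add_zero, ih]
  let v : WithConv (C →ₗ[k] A) := toConv
    { toFun := fun x => s (N x) x
      map_add' := fun x y => by
        have h1 := hs x (N x ⊔ N y ⊔ N (x + y)) (le_sup_left.trans le_sup_left)
        have h2 := hs y (N x ⊔ N y ⊔ N (x + y)) (le_sup_right.trans le_sup_left)
        have h3 := hs (x + y) (N x ⊔ N y ⊔ N (x + y)) le_sup_right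
        rw [← h1, ← h2, ← h3, map_add]
      map_smul' := fun a x => by
        have h1 := hs x (N x ⊔ N (a • x)) le_sup_left
        have h2 := hs (a • x) (N x ⊔ N (a • x)) le_sup_right
        rw [← h1, ← h2, map_smul, RingHom.id_apply] }
  -- on a given tensor, `v` may be replaced by any sufficiently long partial sum
  have hv (x : C) (n : ℕ) (hn : N x ≤ n) : v x = s n x := (hs x n hn).symm
  have hr (w : WithConv (C →ₗ[k] A)) (t : C ⊗[k] C) : ∃ m, ∀ n, m ≤ n →
      map w.ofConv v.ofConv t = map w.ofConv (s n).ofConv t := by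
    induction t with
    | zero => exact ⟨0, fun n _ => by simp⟩
    | add x y hx hy =>
      obtain ⟨m, hm⟩ := hx
      obtain ⟨m', hm'⟩ := hy
      refine ⟨m ⊔ m', fun n hn => ?_⟩
      rw [map_add, map_add, hm n (le_sup_left.trans hn), hm' n (le_sup_right.trans hn)]
    | tmul x y => exact ⟨N y, fun n hn => by rw [map_tmul, map_tmul, hv y n hn]⟩
  have hl (w : WithConv (C →ₗ[k] A)) (t : C ⊗[k] C) : ∃ m, ∀ n, m ≤ n →
      map v.ofConv w.ofConv t = map (s n).ofConv w.ofConv t := by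
    induction t with
    | zero => exact ⟨0, fun n _ => by simp⟩
    | add x y hx hy =>
      obtain ⟨m, hm⟩ := hx
      obtain ⟨m', hm'⟩ := hy
      refine ⟨m ⊔ m', fun n hn => ?_⟩
      rw [map_add, map_add, hm n (le_sup_left.trans hn), hm' n (le_sup_right.trans hn)]
    | tmul x y => exact ⟨N x, fun n hn => by rw [map_tmul, map_tmul, hv x n hn]⟩
  have hone (x : C) (n : ℕ) (hn : N x ≤ n) :
      (1 - u ^ n) x = (1 : WithConv (C →ₗ[k] A)) x := by
    rw [ofConv_sub, LinearMap.sub_apply, hN x n hn, sub_zero]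
  refine ⟨⟨1 - u, v, ?_, ?_⟩, rfl⟩
  · ext x
    obtain ⟨m, hm⟩ := hr (1 - u) (comul x)
    rw [LinearMap.convMul_apply, hm (m ⊔ N x) le_sup_left, ← LinearMap.convMul_apply,
      mul_neg_geom_sum, hone x _ le_sup_right]
  · ext x
    obtain ⟨m, hm⟩ := hl (1 - u) (comul x)
    rw [LinearMap.convMul_apply, hm (m ⊔ N x) le_sup_left, ← LinearMap.convMul_apply,
      geom_sum_mul_neg, hone x _ le_sup_right]

end Convolution

section SkewAntipode

open TensorProduct Coalgebra WithConv MulOpposite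

variable {k A : Type*} [Field k] [Ring A] [HopfAlgebra k A]

variable (k A) in
/-- The identity of `A`, as an element of the convolution algebra of linear maps from `A` to the
opposite algebra. -/
noncomputable def opConv : WithConv (A →ₗ[k] Aᵐᵒᵖ) := toConv (opLinearEquiv k).toLinearMap

lemma map_op_mul (x y : A ⊗[k] A) :
    map (opLinearEquiv k).toLinearMap (opLinearEquiv k).toLinearMap (x * y) =
      map (opLinearEquiv k : A ≃ₗ[k] Aᵐᵒᵖ).toLinearMap (opLinearEquiv k).toLinearMap y *
        map (opLinearEquiv k : A ≃ₗ[k] Aᵐᵒᵖ).toLinearMap (opLinearEquiv k).toLinearMap x := by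
  induction x with
  | zero => simp
  | add x x' hx hx' => simp only [add_mul, mul_add, map_add, hx, hx']
  | tmul a b =>
    induction y with
    | zero => simp
    | add x x' hx hx' => simp only [add_mul, mul_add, map_add, hx, hx']
    | tmul c d => simp

variable (k A) in
/-- The bialgebra with the opposite multiplication and the same comultiplication. -/
noncomputable abbrev mulOppositeBialgebra : Bialgebra k Aᵐᵒᵖ :=
  Bialgebra.mk' k Aᵐᵒᵖ
    (by rw [MulOpposite.counit_def]; simp)
    (fun {a b} => by
      rw [MulOpposite.counit_def]
      simp [mul_comm])
    (by
      rw [MulOpposite.comul_def]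
      simp [Algebra.TensorProduct.one_def])
    (fun {a b} => by
      rw [MulOpposite.comul_def]
      simp only [LinearMap.comp_apply, LinearEquiv.coe_coe, coe_opLinearEquiv_symm, unop_mul,
        Bialgebra.comul_mul, map_op_mul])

/-- A convolution inverse of `opConv` is the antipode of the opposite Hopf algebra. -/
noncomputable abbrev mulOppositeHopfAlgebra {t : WithConv (A →ₗ[k] Aᵐᵒᵖ)} (h1 : t * opConv k A = 1)
    (h2 : opConv k A * t = 1) : HopfAlgebra k Aᵐᵒᵖ :=
  { mulOppositeBialgebra k A with
    antipode := t.ofConv ∘ₗ (opLinearEquiv k).symm.toLinearMap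
    mul_antipode_rTensor_comul := by
      ext a
      have := congr(WithConv.ofConv $h1 (unop a))
      rw [LinearMap.convMul_apply, LinearMap.convOne_apply] at this
      rw [LinearMap.comp_apply, LinearMap.comp_apply, MulOpposite.comul_def, LinearMap.comp_apply,
        ← LinearMap.comp_apply (LinearMap.rTensor _ _), LinearMap.rTensor_comp_map]
      exact this
    mul_antipode_lTensor_comul := by
      ext a
      have := congr(WithConv.ofConv $h2 (unop a))
      rw [LinearMap.convMul_apply, LinearMap.convOne_apply] at this
      rw [LinearMap.comp_apply, LinearMap.comp_apply, MulOpposite.comul_def, LinearMap.comp_apply,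
        ← LinearMap.comp_apply (LinearMap.lTensor _ _), LinearMap.lTensor_comp_map]
      exact this }

/-- If the identity is convolution invertible as a map to the opposite algebra, then the antipode
`S` is bijective: the inverse `T` satisfies `S (T x₍₁₎) S x₍₂₎ = ε x` and
`T x₍₂₎ T (S x₍₁₎) = ε x`, so `S ∘ T` is convolution inverse to `S`, and `T ∘ S` to `T`. -/
lemma bijective_antipode_of_isUnit_opConv (h : IsUnit (opConv k A)) :
    Function.Bijective (HopfAlgebra.antipode k : A →ₗ[k] A) := by
  obtain ⟨⟨j, t, hjt, htj⟩, hj⟩ := h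
  change j = _ at hj
  subst hj
  have hST : toConv (HopfAlgebra.antipode k ∘ₗ (opLinearEquiv k).symm.toLinearMap ∘ₗ t.ofConv) *
      toConv (HopfAlgebra.antipode k (A := A)) = 1 := by
    have h1 (z : A ⊗[k] A) : LinearMap.mul' k A (map (HopfAlgebra.antipode k ∘ₗ
        (opLinearEquiv k).symm.toLinearMap ∘ₗ t.ofConv) (HopfAlgebra.antipode k) z) =
        HopfAlgebra.antipode k (unop
          (LinearMap.mul' k Aᵐᵒᵖ (map t.ofConv (opConv k A).ofConv z))) := by
      induction z with
      | zero => simp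
      | add x y hx hy => simp only [map_add, unop_add, hx, hy]
      | tmul a b => simp [opConv, HopfAlgebra.antipode_mul_antidistrib]
    ext x
    rw [LinearMap.convMul_apply, h1, ← LinearMap.convMul_apply, htj]
    simp [Algebra.algebraMap_eq_smul_one]
  have hTS : toConv (t.ofConv ∘ₗ HopfAlgebra.antipode k) * t = 1 := by
    let _ := mulOppositeHopfAlgebra htj hjt
    have hmul (a b : A) : t (a * b) = t a * t b :=
      HopfAlgebra.antipode_mul_antidistrib (R := k) (op b) (op a)
    have hone : t (1 : A) = 1 := HopfAlgebra.antipode_one (R := k) (A := Aᵐᵒᵖ)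
    have h1 (z : A ⊗[k] A) : LinearMap.mul' k Aᵐᵒᵖ
        (map (t.ofConv ∘ₗ HopfAlgebra.antipode k) t.ofConv z) =
        t (LinearMap.mul' k A ((HopfAlgebra.antipode k).rTensor A z)) := by
      induction z with
      | zero => simp
      | add x y hx hy => simp only [map_add, hx, hy]
      | tmul a b => simp [hmul]
    ext x
    rw [LinearMap.convMul_apply, h1, HopfAlgebra.mul_antipode_rTensor_comul_apply,
      LinearMap.convOne_apply, Algebra.algebraMap_eq_smul_one, map_smul, hone,
      Algebra.algebraMap_eq_smul_one]
  -- left and right convolution inverses of `S`, and of `T`, agree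
  have h1 := left_inv_eq_right_inv hST LinearMap.antipode_mul_id
  have h2 := left_inv_eq_right_inv hTS htj
  refine ⟨Function.LeftInverse.injective (g := fun a => unop (t a)) fun a => ?_,
    Function.RightInverse.surjective (g := fun a => unop (t a)) fun a => ?_⟩
  · have := congr(WithConv.ofConv $h2 a)
    exact congrArg unop this
  · exact congr(WithConv.ofConv $h1 a)

end SkewAntipode

/-! ### The antipode of the bosonization is bijective -/

section Antipode

open TensorProduct Coalgebra WithConv MulOpposite Bosonization YetterDrinfeld

variable {k H R : Type*} [Field k] [Ring H] [HopfAlgebra k H] [Ring R] [Algebra k R]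
  [Coalgebra k R] [BraidedHopfAlgebra k H R]

lemma comul_sub_mem_of_rightContract {C : Type*} [AddCommGroup C] [Module k C] [Coalgebra k C]
    {e : C} (he : IsGroupLikeElem k e) {F : Submodule k C} {x : C}
    (hx : ∀ f ∈ vanishing he, rightContract f x ∈ F) :
    comul (R := k) x - x ⊗ₜ e ∈ LinearMap.range (F.subtype.rTensor C) := by
  refine mem_range_rTensor_iff.2 fun f => ?_
  have h2 := hx _ (sub_smul_one_mem_vanishing he (toConv f))
  rw [sub_eq_add_neg, ← neg_smul, rightContract_add, rightContract_smul, rightContract_one,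
    neg_smul, ← sub_eq_add_neg] at h2
  rw [map_sub, rightSlice_tmul]
  exact h2

lemma comul_inl_mul_inr (r : R) (h : H) :
    comul (R := k) (inl k R H r * inr k R H h) = FD k R H (comul r) * gD k R H h := by
  rw [← comulHom_inl, ← comulHom_inr, ← map_mul]
  rfl

section

variable {A : Type*} [Ring A] [Algebra k A]

lemma map_FD_mul_gD_eq_zero (v w : Bosonization k R H →ₗ[k] A) {a : R}
    (hv : ∀ c : H, v (inl k R H a * inr k R H c) = 0) (b : R) (h : H) :
    map v w (FD k R H (a ⊗ₜ b) * gD k R H h) = 0 := by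
  rw [FD_tmul, Psi_apply, gD_apply]
  generalize coact (k := k) (H := H) b = y
  generalize comul (R := k) h = t
  induction t with
  | zero => simp
  | add x y hx hy => simp only [map_add, mul_add, hx, hy, add_zero]
  | tmul c d =>
    induction y with
    | zero => simp
    | add x y hx hy => simp only [map_add, mul_add, add_mul, hx, hy, add_zero]
    | tmul p q =>
      have := hv (p * c)
      rw [map_mul (inr k R H), ← mul_assoc] at this
      simp [psi_tmul, io_apply, this]

lemma map_FD_tmul_one_mul_gD_eq_zero (v w : Bosonization k R H →ₗ[k] A)
    (hw : ∀ c : H, w (inr k R H c) = 0) (a : R) (h : H) :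
    map v w (FD k R H (a ⊗ₜ 1) * gD k R H h) = 0 := by
  rw [FD_tmul, map_one, mul_one, gD_apply]
  generalize comul (R := k) h = t
  induction t with
  | zero => simp
  | add x y hx hy => simp only [map_add, mul_add, hx, hy, add_zero]
  | tmul c d => simp [io_apply, hw]

/-- A map that vanishes on `1 # H` is locally nilpotent for convolution: its power `n + 1` vanishes
on the elements `r # h` with `r` of filtration degree at most `n`. -/
lemma locally_nilpotent_of_inr_eq_zero (he : IsGroupLikeElem k (1 : R))
    (hex : ∀ r : R, ∃ n, r ∈ groupLikeFiltration he n)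
    (u : WithConv (Bosonization k R H →ₗ[k] A)) (hu : ∀ h : H, u (inr k R H h) = 0)
    (x : Bosonization k R H) : ∃ n, ∀ m, n ≤ m → (u ^ m) x = 0 := by
  have hstep (n : ℕ) : ∀ r ∈ groupLikeFiltration he n, ∀ h : H,
      (u ^ (n + 1)) (inl k R H r * inr k R H h) = 0 := by
    induction n with
    | zero =>
      intro r hr h
      rw [eq_smul_of_mem_groupLikeFiltration_zero hr, zero_add, pow_one, map_smul, map_one,
        smul_mul_assoc, one_mul, map_smul, hu, smul_zero]
    | succ n ih =>
      intro r hr h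
      obtain ⟨z, hz⟩ := comul_sub_mem_of_rightContract he fun f hf =>
        rightContract_mem_groupLikeFiltration hr hf
      have h1 : map (u ^ (n + 1)).ofConv u.ofConv (FD k R H
          ((groupLikeFiltration he n).subtype.rTensor R z) * gD k R H h) = 0 := by
        clear hz
        induction z with
        | zero => simp
        | add x y hx hy => simp only [map_add, add_mul, hx, hy, add_zero]
        | tmul a b => exact map_FD_mul_gD_eq_zero _ _ (ih a a.2) b h
      rw [pow_succ, LinearMap.convMul_apply, comul_inl_mul_inr, ← sub_add_cancel (comul r)
        (r ⊗ₜ[k] (1 : R)), ← hz, map_add, add_mul, map_add, h1,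
        map_FD_tmul_one_mul_gD_eq_zero _ _ hu, add_zero, map_zero]
  induction x using Bosonization.induction with
  | zero => exact ⟨0, fun m _ => map_zero _⟩
  | add x y hx hy =>
    obtain ⟨n, hn⟩ := hx
    obtain ⟨n', hn'⟩ := hy
    refine ⟨n ⊔ n', fun m hm => ?_⟩
    rw [map_add, hn m (le_sup_left.trans hm), hn' m (le_sup_right.trans hm), add_zero]
  | mul r h =>
    obtain ⟨n, hn⟩ := hex r
    refine ⟨n + 1, fun m hm => ?_⟩
    obtain ⟨m, rfl⟩ := Nat.exists_eq_add_of_le' (Nat.le_of_add_left_le hm)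
    exact hstep m r (groupLikeFiltration_mono he (Nat.le_of_succ_le_succ hm) hn) h

end

/-- The antipode of the bosonization of a connected braided Hopf algebra is bijective if that of
`H` is. The map `r # h ↦ ε r S⁻¹ h` is convolution inverse to the identity on `H`, with values in
the opposite algebra, so it is an inverse up to locally nilpotent maps. -/
lemma bijective_antipode_bosonization
    (hH : Function.Bijective (HopfAlgebra.antipode k : H →ₗ[k] H))
    (hR : IsConnectedCoalgebra k R) : Function.Bijective
      (HopfAlgebra.antipode k : Bosonization k R H →ₗ[k] Bosonization k R H) := by
  have he := BraidedHopfAlgebra.isGroupLikeElem_one k H R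
  have hex := exists_mem_groupLikeFiltration he (one_mem_of_isConnectedCoalgebra hR)
  let σ : H →ₗ[k] H := (LinearEquiv.ofBijective _ hH).symm.toLinearMap
  have hσ (h : H) : HopfAlgebra.antipode k (σ h) = h :=
    (LinearEquiv.ofBijective _ hH).apply_symm_apply h
  let g : H →ₗ[k] (Bosonization k R H)ᵐᵒᵖ :=
    (opLinearEquiv k).toLinearMap ∘ₗ (inr k R H).toLinearMap ∘ₗ σ
  let t : WithConv (Bosonization k R H →ₗ[k] (Bosonization k R H)ᵐᵒᵖ) :=
    toConv (liftLin (LinearMap.toSpanSingleton k _ 1 ∘ₗ counit) g)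
  have ht (h : H) : t (inr k R H h) = op (inr k R H (σ h)) := by
    have := liftLin_apply (k := k) (R := R) (H := H)
      (LinearMap.toSpanSingleton k (Bosonization k R H)ᵐᵒᵖ 1 ∘ₗ counit) g 1 h
    rw [map_one, one_mul] at this
    refine this.trans ?_
    simp [g, he.counit_eq_one]
  have hσ1 (h : H) : LinearMap.mul' k H (TensorProduct.comm k H H (σ.rTensor H (comul h))) =
      algebraMap k H (counit h) := by
    apply hH.1
    have h1 (z : H ⊗[k] H) : HopfAlgebra.antipode k
        (LinearMap.mul' k H (TensorProduct.comm k H H (σ.rTensor H z))) =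
        LinearMap.mul' k H ((HopfAlgebra.antipode k).lTensor H z) := by
      induction z with
      | zero => simp
      | add x y hx hy => simp only [map_add, hx, hy]
      | tmul a b => simp [HopfAlgebra.antipode_mul_antidistrib, hσ]
    rw [h1, HopfAlgebra.mul_antipode_lTensor_comul_apply, Algebra.algebraMap_eq_smul_one,
      map_smul, HopfAlgebra.antipode_one]
  have hσ2 (h : H) : LinearMap.mul' k H (TensorProduct.comm k H H (σ.lTensor H (comul h))) =
      algebraMap k H (counit h) := by
    apply hH.1
    have h1 (z : H ⊗[k] H) : HopfAlgebra.antipode k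
        (LinearMap.mul' k H (TensorProduct.comm k H H (σ.lTensor H z))) =
        LinearMap.mul' k H ((HopfAlgebra.antipode k).rTensor H z) := by
      induction z with
      | zero => simp
      | add x y hx hy => simp only [map_add, hx, hy]
      | tmul a b => simp [HopfAlgebra.antipode_mul_antidistrib, hσ]
    rw [h1, HopfAlgebra.mul_antipode_rTensor_comul_apply, Algebra.algebraMap_eq_smul_one,
      map_smul, HopfAlgebra.antipode_one]
  have hcomul (h : H) : comul (R := k) (inr k R H h) =
      map (inr k R H).toLinearMap (inr k R H).toLinearMap (comul h) :=
    comulHom_inr h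
  have hcounit (h : H) : counit (R := k) (inr k R H h) = counit (R := k) h := counitHom_inr h
  have htj (h : H) : (t * opConv k (Bosonization k R H)) (inr k R H h) =
      (1 : WithConv (Bosonization k R H →ₗ[k] (Bosonization k R H)ᵐᵒᵖ)) (inr k R H h) := by
    have h1 (z : H ⊗[k] H) : LinearMap.mul' k _ (map t.ofConv (opConv k (Bosonization k R H)).ofConv
        (map (inr k R H).toLinearMap (inr k R H).toLinearMap z)) =
        op (inr k R H (LinearMap.mul' k H (TensorProduct.comm k H H (σ.rTensor H z)))) := by
      induction z with
      | zero => simp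
      | add x y hx hy => simp only [map_add, op_add, hx, hy]
      | tmul a b => simp [opConv, ht]
    rw [LinearMap.convMul_apply, LinearMap.convOne_apply, hcomul, h1, hσ1, AlgHom.commutes,
      hcounit, MulOpposite.algebraMap_apply]
  have hjt (h : H) : (opConv k (Bosonization k R H) * t) (inr k R H h) =
      (1 : WithConv (Bosonization k R H →ₗ[k] (Bosonization k R H)ᵐᵒᵖ)) (inr k R H h) := by
    have h1 (z : H ⊗[k] H) : LinearMap.mul' k _ (map (opConv k (Bosonization k R H)).ofConv t.ofConv
        (map (inr k R H).toLinearMap (inr k R H).toLinearMap z)) =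
        op (inr k R H (LinearMap.mul' k H (TensorProduct.comm k H H (σ.lTensor H z)))) := by
      induction z with
      | zero => simp
      | add x y hx hy => simp only [map_add, op_add, hx, hy]
      | tmul a b => simp [opConv, ht]
    rw [LinearMap.convMul_apply, LinearMap.convOne_apply, hcomul, h1, hσ2, AlgHom.commutes,
      hcounit, MulOpposite.algebraMap_apply]
  have hunit (w : WithConv (Bosonization k R H →ₗ[k] (Bosonization k R H)ᵐᵒᵖ))
      (hw : ∀ h : H, w (inr k R H h) =
        (1 : WithConv (Bosonization k R H →ₗ[k] (Bosonization k R H)ᵐᵒᵖ)) (inr k R H h)) :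
      IsUnit w := by
    rw [← sub_sub_cancel 1 w]
    refine isUnit_one_sub_of_locally_nilpotent _ (locally_nilpotent_of_inr_eq_zero he hex _ ?_)
    intro h
    rw [ofConv_sub, LinearMap.sub_apply, hw, sub_self]
  refine bijective_antipode_of_isUnit_opConv ?_
  obtain ⟨a, ha⟩ := (hunit _ htj).exists_left_inv
  obtain ⟨b, hb⟩ := (hunit _ hjt).exists_right_inv
  rw [← mul_assoc] at ha
  rw [mul_assoc] at hb
  exact ⟨⟨opConv k (Bosonization k R H), t * b, hb, left_inv_eq_right_inv ha hb ▸ ha⟩, rfl⟩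

end Antipode

/-! ### Free right modules are faithfully flat -/

section FaithfullyFlat

open MulOpposite TensorProduct

variable {A M ι N : Type*} [Ring A] [AddCommGroup M] [Module Aᵐᵒᵖ M] [AddCommGroup N] [Module A N]

/-- The coordinates `M ⊗_A N → N^(ι)`, `m ⊗ n ↦ (mᵢ n)ᵢ`, with respect to a basis of the right
module `M`. -/
noncomputable def balancedCoords (b : Module.Basis ι Aᵐᵒᵖ M) : BalancedTensor A M N →+ (ι →₀ N) :=
  QuotientAddGroup.lift _
    (TensorProduct.liftAddHom
      (AddMonoidHom.mk' (fun m => AddMonoidHom.mk'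
          (fun n => (b.repr m).mapRange (fun a => unop a • n) (by simp))
          (fun n n' => by ext i; simp))
        (fun m m' => by ext n i; simp [add_smul]))
      (fun c m n => by ext i; simp [mul_smul, Int.cast_smul_eq_zsmul])) <| by
    refine (AddSubgroup.closure_le _).2 ?_
    rintro _ ⟨m, a, n, rfl⟩
    refine (AddMonoidHom.mem_ker).2 ?_
    rw [map_sub, sub_eq_zero]
    ext i
    simp [mul_smul]

lemma balancedCoords_tmul (b : Module.Basis ι Aᵐᵒᵖ M) (m : M) (n : N) :
    balancedCoords b (QuotientAddGroup.mk (m ⊗ₜ[ℤ] n)) =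
      (b.repr m).mapRange (fun a => unop a • n) (by simp) := rfl

lemma balancedTensor_smul_tmul (m : M) (a : Aᵐᵒᵖ) (n : N) :
    (QuotientAddGroup.mk ((a • m) ⊗ₜ[ℤ] n) : BalancedTensor A M N) =
      QuotientAddGroup.mk (m ⊗ₜ[ℤ] (unop a • n)) := by
  rw [← sub_eq_zero, ← QuotientAddGroup.mk_sub, QuotientAddGroup.eq_zero_iff]
  exact AddSubgroup.subset_closure ⟨m, unop a, n, rfl⟩

lemma balancedCoords_bijective (b : Module.Basis ι Aᵐᵒᵖ M) :
    Function.Bijective (balancedCoords b : BalancedTensor A M N →+ (ι →₀ N)) := by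
  let inv : (ι →₀ N) →+ BalancedTensor A M N := Finsupp.liftAddHom fun i =>
    (QuotientAddGroup.mk' (balancedRel A M N)).comp (TensorProduct.mk ℤ M N (b i)).toAddMonoidHom
  have hinv (i : ι) (n : N) : inv (Finsupp.single i n) = QuotientAddGroup.mk (b i ⊗ₜ[ℤ] n) :=
    Finsupp.liftAddHom_apply_single _ _ _
  refine ⟨Function.LeftInverse.injective (g := inv) fun z => ?_,
    Function.RightInverse.surjective (g := inv) fun l => ?_⟩
  · obtain ⟨z, rfl⟩ := QuotientAddGroup.mk_surjective z
    induction z with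
    | zero => rw [QuotientAddGroup.mk_zero, map_zero, map_zero]
    | add x y hx hy => rw [QuotientAddGroup.mk_add, map_add, map_add, hx, hy]
    | tmul m n =>
      obtain ⟨l, rfl⟩ := b.repr.symm.surjective m
      induction l using Finsupp.induction_linear with
      | zero => rw [map_zero, zero_tmul, QuotientAddGroup.mk_zero, map_zero, map_zero]
      | add l l' hl hl' =>
        rw [map_add, add_tmul, QuotientAddGroup.mk_add, map_add, map_add, hl, hl']
      | single i a =>
        rw [balancedCoords_tmul, LinearEquiv.apply_symm_apply, Finsupp.mapRange_single, hinv,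
          ← balancedTensor_smul_tmul, Module.Basis.repr_symm_single]
  · induction l using Finsupp.induction_linear with
    | zero => rw [map_zero, map_zero]
    | add l l' hl hl' => rw [map_add, map_add, hl, hl']
    | single i n =>
      rw [hinv, balancedCoords_tmul, Module.Basis.repr_self, Finsupp.mapRange_single]
      simp

lemma balancedCoords_lTensor {N' : Type*} [AddCommGroup N'] [Module A N']
    (b : Module.Basis ι Aᵐᵒᵖ M) (f : N →ₗ[A] N') (z : BalancedTensor A M N) :
    balancedCoords b (balancedLTensor A M f z) =
      Finsupp.mapRange.addMonoidHom f.toAddMonoidHom (balancedCoords b z) := by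
  obtain ⟨z, rfl⟩ := QuotientAddGroup.mk_surjective z
  induction z with
  | zero => rw [QuotientAddGroup.mk_zero, map_zero, map_zero, map_zero, map_zero]
  | add x y hx hy => rw [QuotientAddGroup.mk_add, map_add, map_add, map_add, map_add, hx, hy]
  | tmul m n =>
    have : balancedLTensor A M f (QuotientAddGroup.mk (m ⊗ₜ[ℤ] n)) =
      QuotientAddGroup.mk (m ⊗ₜ[ℤ] f n) := rfl
    rw [this, balancedCoords_tmul, balancedCoords_tmul]
    ext i
    simp

lemma exact_mapRange_iff {N₁ N₂ N₃ : Type*} [AddCommGroup N₁] [AddCommGroup N₂] [AddCommGroup N₃]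
    [Nonempty ι] (f : N₁ →+ N₂) (g : N₂ →+ N₃) :
    Function.Exact (Finsupp.mapRange.addMonoidHom f : (ι →₀ N₁) →+ _)
      (Finsupp.mapRange.addMonoidHom g : (ι →₀ N₂) →+ _) ↔ Function.Exact f g := by
  classical
  constructor
  · intro h y
    obtain ⟨i⟩ := ‹Nonempty ι›
    have h1 := h (Finsupp.single i y)
    rw [Finsupp.mapRange.addMonoidHom_apply, Finsupp.mapRange_single,
      Finsupp.single_eq_zero] at h1
    refine h1.trans ⟨?_, ?_⟩
    · rintro ⟨x, hx⟩
      exact ⟨x i, by simpa using DFunLike.congr_fun hx i⟩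
    · rintro ⟨x, rfl⟩
      exact ⟨Finsupp.single i x, by simp⟩
  · intro h y
    constructor
    · intro hy
      have hy' (i : ι) : y i ∈ Set.range f := (h _).1 (DFunLike.congr_fun hy i)
      -- a section of `f` over its range that preserves zero, so that it applies to finitely
      -- supported families
      let s : N₂ → N₁ := fun y => if hy : y ∈ Set.range f ∧ y ≠ 0 then hy.1.choose else 0
      have hs (y : N₂) (hy : y ∈ Set.range f) : f (s y) = y := by
        by_cases h0 : y = 0
        · simp [s, h0]
        · have h1 : y ∈ Set.range f ∧ y ≠ 0 := ⟨hy, h0⟩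
          simp only [s, dif_pos h1]
          exact h1.1.choose_spec
      refine ⟨y.mapRange s (by simp [s]), ?_⟩
      ext i
      exact hs _ (hy' i)
    · rintro ⟨x, rfl⟩
      ext i
      exact (h _).2 ⟨x i, rfl⟩

lemma isRightFaithfullyFlat_of_free [Module.Free Aᵐᵒᵖ M] [Nontrivial M] :
    IsRightFaithfullyFlat.{w} A M := by
  intro N₁ N₂ N₃ _ _ _ _ _ _ f g
  obtain ⟨⟨ι, b⟩⟩ := Module.Free.exists_basis (R := Aᵐᵒᵖ) (M := M)
  have : Nonempty ι := b.index_nonempty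
  let e (N : Type w) [AddCommGroup N] [Module A N] : BalancedTensor A M N ≃+ (ι →₀ N) :=
    AddEquiv.ofBijective (balancedCoords b) (balancedCoords_bijective b)
  have h1 := Function.Exact.iff_of_ladder_addEquiv (e₁ := e N₁) (e₂ := e N₂) (e₃ := e N₃)
    (f₁₂ := balancedLTensor A M f) (f₂₃ := balancedLTensor A M g)
    (g₁₂ := Finsupp.mapRange.addMonoidHom f.toAddMonoidHom)
    (g₂₃ := Finsupp.mapRange.addMonoidHom g.toAddMonoidHom)
    (AddMonoidHom.ext fun z => (balancedCoords_lTensor b f z).symm)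
    (AddMonoidHom.ext fun z => (balancedCoords_lTensor b g z).symm)
  exact (exact_mapRange_iff (ι := ι) f.toAddMonoidHom g.toAddMonoidHom).symm.trans h1

end FaithfullyFlat

/-! ### The bosonization over a left coideal subalgebra -/

section Bosonization

open TensorProduct Coalgebra MulOpposite Bosonization YetterDrinfeld

/-- A bijective antipode exchanges left modules over `B` and right modules over its image. -/
lemma isRightFreeOver_antipodeImage {k A : Type*} [Field k] [Ring A] [HopfAlgebra k A]
    (hS : Function.Bijective (HopfAlgebra.antipode k : A →ₗ[k] A)) (B : Subalgebra k A)
    (hB : IsLeftFreeOver B) : IsRightFreeOver (antipodeImage B) := by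
  let φ : B →+* (antipodeImage B)ᵐᵒᵖ :=
    { toFun := fun b => op ⟨HopfAlgebra.antipode k (b : A), b, b.2, rfl⟩
      map_one' := unop_injective (Subtype.ext HopfAlgebra.antipode_one)
      map_mul' := fun a b => unop_injective
        (Subtype.ext (HopfAlgebra.antipode_mul_antidistrib (a : A) b))
      map_zero' := unop_injective (Subtype.ext (map_zero _))
      map_add' := fun a b => unop_injective (Subtype.ext (map_add _ (a : A) b)) }
  have hφ : Function.Bijective φ := by
    refine ⟨fun a b h => Subtype.ext (hS.1 (congrArg (fun y => ((unop y : antipodeImage B) : A)) h)),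
      fun y => ?_⟩
    obtain ⟨⟨_, b, hb, rfl⟩, rfl⟩ := op_surjective y
    exact ⟨⟨b, hb⟩, rfl⟩
  let ψ : B ≃+* (antipodeImage B)ᵐᵒᵖ := RingEquiv.ofBijective φ hφ
  let _ := rightModule (antipodeImage B)
  have : Module.Free B A := hB
  have := RingHomInvPair.of_ringEquiv ψ
  have := RingHomInvPair.of_ringEquiv ψ.symm
  let e : A ≃ₛₗ[(ψ : B →+* (antipodeImage B)ᵐᵒᵖ)] A :=
    { (LinearEquiv.ofBijective _ hS).toAddEquiv with
      map_smul' := fun b a => HopfAlgebra.antipode_mul_antidistrib (b : A) a }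
  exact Module.Free.of_equiv e

variable {k H R : Type*} [Field k] [Ring H] [HopfAlgebra k H] [Ring R] [Algebra k R]
  [Coalgebra k R] [BraidedHopfAlgebra k H R]

variable (k H R) in
lemma inl_injective : Function.Injective (inl k R H) := by
  refine Function.LeftInverse.injective
    (g := fun x => TensorProduct.rid k R (LinearMap.lTensor R counit x)) fun r => ?_
  change TensorProduct.rid k R (LinearMap.lTensor R counit (r ⊗ₜ[k] (1 : H))) = r
  simp

/-- As a left `B`-module, the bosonization is the extension `R ⊗ H` of the left `B`-module `R`. -/
lemma isLeftFreeOver_ofSubalgebra (B : Subalgebra k R) [Module.Free B R] :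
    IsLeftFreeOver (ofSubalgebra H B) := by
  let ψ : B ≃+* ofSubalgebra H B :=
    (B.equivMapOfInjective (inl k R H) (inl_injective k H R)).toRingEquiv
  have := RingHomInvPair.of_ringEquiv ψ
  have := RingHomInvPair.of_ringEquiv ψ.symm
  have hsmul (b : B) (z : R ⊗[k] H) : b • z = mulMap k R H ((b : R) ⊗ₜ 1) z := by
    rw [mulMap_tmul, map_one, mul_one]
    induction z with
    | zero => rw [smul_zero, map_zero]
    | add x y hx hy => rw [smul_add, map_add, hx, hy]
    | tmul r h =>
      rw [lam_tmul]
      rfl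
  let e : (R ⊗[k] H) ≃ₛₗ[(ψ : B →+* ofSubalgebra H B)] Bosonization k R H :=
    { (AddEquiv.refl (R ⊗[k] H) : R ⊗[k] H ≃+ Bosonization k R H) with
      map_smul' := hsmul }
  have : Module.Free B (R ⊗[k] H) := Module.Free.tensor
  exact Module.Free.of_equiv e

lemma isLeftCoideal_ofSubalgebra {B : Subalgebra k R} (hB : IsBraidedLeftCoidealSubalgebra H B) :
    IsLeftCoideal k (Subalgebra.toSubmodule (ofSubalgebra H B)) := by
  have h1 (b : B) : inl k R H (b : R) ∈ Subalgebra.toSubmodule (ofSubalgebra H B) := ⟨b, b.2, rfl⟩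
  rintro _ ⟨b, hb, rfl⟩
  change comulHom k R H (inl k R H b) ∈ _
  rw [comulHom_inl]
  obtain ⟨z, hz⟩ := hB.2 b hb
  rw [← hz]
  clear hz
  induction z with
  | zero => simp
  | add x y hx hy =>
    rw [map_add, map_add]
    exact Submodule.add_mem _ hx hy
  | tmul r c =>
    rw [LinearMap.lTensor_tmul, FD_tmul, Psi_apply]
    obtain ⟨y, hy⟩ := hB.1 c c.2
    change io k R H r * psi k R H (coact (c : R)) ∈ _
    rw [← hy]
    clear hy
    induction y with
    | zero => simp
    | add x y hx hy =>
      rw [map_add, map_add, mul_add]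
      exact Submodule.add_mem _ hx hy
    | tmul a c' =>
      exact ⟨(inl k R H r * inr k R H a) ⊗ₜ ⟨inl k R H (c' : R), h1 c'⟩, by
        simp [psi_tmul, io_apply]⟩

end Bosonization

theorem mainTheorem11 {k H R : Type*} [Field k] [IsAlgClosed k]
    [Ring H] [HopfAlgebra k H]
    (hH : Function.Bijective (HopfAlgebra.antipode k : H →ₗ[k] H))
    [Ring R] [Algebra k R] [Coalgebra k R] [BraidedHopfAlgebra k H R]
    (hR : IsConnectedCoalgebra k R)
    (B : Subalgebra k R) (hB : IsBraidedLeftCoidealSubalgebra H B) :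
    IsLeftCoideal k (Subalgebra.toSubmodule (Bosonization.ofSubalgebra H B)) ∧
      IsLeftFreeOver (Bosonization.ofSubalgebra H B) ∧
      IsRightFreeOver (antipodeImage (Bosonization.ofSubalgebra H B)) ∧
      IsRightFaithfullyFlatOver.{w} (antipodeImage (Bosonization.ofSubalgebra H B)) := by
  have : Module.Free B R := free_of_isBraidedLeftCoidealSubalgebra hR hB
  have hl := isLeftFreeOver_ofSubalgebra (H := H) B
  have hr := isRightFreeOver_antipodeImage (bijective_antipode_bosonization hH hR) _ hl
  refine ⟨isLeftCoideal_ofSubalgebra hB, hl, hr, ?_⟩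
  let _ := rightModule (antipodeImage (Bosonization.ofSubalgebra H B))
  have : Module.Free (antipodeImage (Bosonization.ofSubalgebra H B))ᵐᵒᵖ (Bosonization k R H) := hr
  -- the counit of `R` maps `1` to `1`, so `R` and `R # H` are nontrivial
  have : Nontrivial R := ⟨1, 0, fun h => one_ne_zero (α := k) (by
    rw [← BraidedHopfAlgebra.counit_one (k := k) (H := H) (R := R), h, map_zero])⟩
  have : Nontrivial (Bosonization k R H) := (inl_injective k H R).nontrivial
  exact isRightFaithfullyFlat_of_free
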